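/- Let $\alpha>0$. Percolation with constant freezing (PCF) at rate $\alpha$ on a finite graph is the continuous-time Markov chain in which every vertex is warm or frozen and every edge is open or closed; initially all vertices are warm and all edges are closed; every closed edge whose two ends are both warm opens at rate $1$, and every cluster (connected component of the graph formed by all vertices and the open edges) with warm vertices freezes, i.e. all its vertices become frozen, at rate $\alpha$. As $t\to\infty$ its law converges to the law of a final configuration. On an infinite graph $G$, the PCF measure is the probability measure on $\{0,1\}^{E(G)}$ that is the local limit of the laws of the final edge configurations on the finite induced subgraphs of $G$: for every finite set $F$ of edges, the law of the final states of the edges in $F$ for PCF on the subgraph induced by a finite vertex set $S$ (edges outside of it being closed) converges, as $S$ increases to the whole vertex set, to the law of the states of the edges in $F$ under the measure. **Theorem.** Let $d\ge 1$ be an integer, let $\alpha>0$, and let $\mathbf T_d$ be the rooted $d$-ary tree (every vertex, including the root, has exactly $d$ children). The PCF measure $\mu=\mu_{\mathbf T_d,\alpha}$ at rate $\alpha$ exists. Let $P_k=\mu(A_k)$, where $A_k$ is the event that the open cluster of the root in the final configuration has exactly $k$ vertices. 1. If $\alpha<d-1$, there is a constant $C=C_{d,\alpha}>0$ such that $P_k\sim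 C\,k^{-2}$ as $k\to\infty$. 2. If $\alpha=d-1$, there is a constant $C=C_d>0$ such that $P_k\sim C\,k^{-\left(2-\frac1{2d}\right)}$ as $k\to\infty$. 3. If $\alpha>d-1$, then $P_k$ decays exponentially in $k$: there are constants $C,c>0$, depending on $d$ and $\alpha$, such that $P_k\le C\mathrm e^{-ck}$ for all $k$. -/

import Mathlib

open Filter Topology MeasureTheory Asymptotics

open scoped Classical

/-- A configuration of a graph `G`: every vertex is warm (`true`) or frozen (`false`), and every
edge is open (`true`) or closed (`false`). -/
abbrev PCFConfig {V : Type*} (G : SimpleGraph V) : Type _ :=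
  (V → Bool) × (G.edgeSet → Bool)

/-- The graph formed by the open edges of an edge configuration. -/
def openGraph {V : Type*} {G : SimpleGraph V} (σ : G.edgeSet → Bool) : SimpleGraph V where
  Adj u v := ∃ h : G.Adj u v, σ ⟨s(u, v), h⟩ = true
  symm := ⟨by
    rintro u v ⟨h, hσ⟩
    refine ⟨h.symm, ?_⟩
    have key : (⟨s(v, u), h.symm⟩ : G.edgeSet) = ⟨s(u, v), h⟩ := Subtype.ext Sym2.eq_swap
    rw [key]
    exact hσ⟩
  loopless := ⟨by
    rintro v ⟨h, -⟩
    exact G.loopless.irrefl v h⟩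

/-- The open cluster of the vertex `v`: all vertices joined to `v` by a path of open edges. -/
def openCluster {V : Type*} {G : SimpleGraph V} (σ : G.edgeSet → Bool) (v : V) : Set V :=
  {w | (openGraph σ).Reachable v w}

/-- The configuration obtained from `η` by opening the edge `e`. -/
noncomputable def openEdge {V : Type*} {G : SimpleGraph V} (η : PCFConfig G) (e : G.edgeSet) :
    PCFConfig G :=
  (η.1, fun e' => if e' = e then true else η.2 e')

/-- The configuration obtained from `η` by freezing all the vertices of `C`. -/
noncomputable def freezeSet {V : Type*} {G : SimpleGraph V} (η : PCFConfig G) (C : Set V) :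
    PCFConfig G :=
  (fun v => if v ∈ C then false else η.1 v, η.2)

/-- Jump rates of percolation with constant freezing on a finite graph: an edge whose two ends are
both warm opens at rate `1`, and every open cluster freezes at rate `α`. (Opening an open edge or
freezing a frozen cluster contributes only to the rate from `η` to `η`, which has no effect on the
generator. Off the diagonal at most one of the summands is not zero.) -/
noncomputable def pcfRate {V : Type*} [Finite V] (G : SimpleGraph V) (α : ℝ)
    (η θ : PCFConfig G) : ℝ :=
  (∑ᶠ e : G.edgeSet, if (∀ v ∈ (e : Sym2 V), η.1 v = true) ∧ θ = openEdge η e then (1 : ℝ) else 0) +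
    ∑ᶠ C : (openGraph η.2).ConnectedComponent, if θ = freezeSet η C.supp then α else 0

/-- The finitely many configurations of a finite graph. -/
noncomputable instance pcfConfigFintype {V : Type*} [Finite V] (G : SimpleGraph V) :
    Fintype (PCFConfig G) :=
  Fintype.ofFinite _

/-- The generator (`Q`-matrix) of percolation with constant freezing on a finite graph. -/
noncomputable def pcfGenerator {V : Type*} [Finite V] (G : SimpleGraph V) (α : ℝ) :
    Matrix (PCFConfig G) (PCFConfig G) ℝ :=
  Matrix.of fun η θ => pcfRate G α η θ - if η = θ then ∑ ξ, pcfRate G α η ξ else 0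

/-- The initial configuration: all vertices warm, all edges closed. -/
def pcfInit {V : Type*} (G : SimpleGraph V) : PCFConfig G :=
  (fun _ => true, fun _ => false)

/-- The law at time `t` of percolation with constant freezing on a finite graph, that is of the
continuous time Markov chain with the above generator and initial configuration. -/
noncomputable def pcfLaw {V : Type*} [Finite V] (G : SimpleGraph V) (α t : ℝ)
    (η : PCFConfig G) : ℝ :=
  NormedSpace.exp (t • pcfGenerator G α) (pcfInit G) η

/-- `ν` is the distribution of the final configuration on a finite graph: the limit, as `t → ∞`,
of the laws at time `t`. -/
def IsPCFFinalLaw {V : Type*} [Finite V] (G : SimpleGraph V) (α : ℝ)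
    (ν : PCFConfig G → ℝ) : Prop :=
  ∀ η, Tendsto (fun t : ℝ => pcfLaw G α t η) atTop (𝓝 (ν η))

/-- The edge configuration on `G` obtained from one on the subgraph induced by `S`: the edges
outside of this subgraph are closed. -/
noncomputable def extendEdges {V : Type*} {G : SimpleGraph V} {S : Set V}
    (σ : (G.induce S).edgeSet → Bool) (e : G.edgeSet) : Bool :=
  decide (∃ e' : (G.induce S).edgeSet,
    Sym2.map Subtype.val (e' : Sym2 S) = (e : Sym2 V) ∧ σ e' = true)

/-- `μ` is the (final) measure of rate `α` percolation with constant freezing on the possibly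
infinite graph `G`, in the sense of local limits: for every finite set `F` of edges, the law of
the states of the edges of `F` in the final configuration on the subgraph induced by a finite
vertex set `S` converges, as `S` exhausts the vertices of `G`, to the law of the states of the
edges of `F` under `μ`. -/
structure IsPCFMeasure {V : Type*} (G : SimpleGraph V) (α : ℝ)
    (μ : Measure (G.edgeSet → Bool)) : Prop where
  isProbabilityMeasure : IsProbabilityMeasure μ
  exists_localLimit : ∃ ν : ∀ S : Finset V, PCFConfig (G.induce (S : Set V)) → ℝ,
    (∀ S : Finset V, IsPCFFinalLaw (G.induce (S : Set V)) α (ν S)) ∧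
    ∀ (F : Finset G.edgeSet) (ω : G.edgeSet → Bool),
      Tendsto (fun S : Finset V => ∑ η, if ∀ e ∈ F, extendEdges η.2 e = ω e then ν S η else 0)
        atTop (𝓝 (μ.real {σ | ∀ e ∈ F, σ e = ω e}))

/-- The rooted `d`-ary tree: the vertices are the words over an alphabet of `d` letters, the root
is the empty word, and the children of `u` are the `d` words `i :: u`. -/
def daryTree (d : ℕ) : SimpleGraph (List (Fin d)) :=
  SimpleGraph.fromRel fun u v => ∃ i : Fin d, v = i :: u

/-- The event that the cluster of the root of the `d`-ary tree has exactly `k` vertices. -/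
def rootClusterSize (d k : ℕ) : Set ((daryTree d).edgeSet → Bool) :=
  {σ | (openCluster σ []).encard = k}

/-!
Percolation with constant freezing (PCF) on the `d`-ary tree is solvable because a vertex freezes at
rate `α` whatever happens below it. If an edge joins two warm clusters of the tree, the clock of the
cluster nearer to the root can be kept and the other one discarded. Hence the root freezes at an
exponential time, and given this time its cluster is a cluster of Bernoulli percolation: an edge to
a child is open with probability `q`, where `q = (1 - y) / (1 + α)` and `y = exp (-(1 + α) t)`. As
`y` varies over `(0, 1)`, so does `q` over `(0, 1 / (1 + α))`, and the critical parameter `1 / d`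
lies inside this interval, at its end or outside according to whether `α` is less than, equal to or
greater than `d - 1`. The time `t` has the weight `y ^ (-1 / (1 + α))`, up to a constant, as a
density in `y`; its singularity at `y = 0` meets the critical parameter only when `α = d - 1`, and
this produces the exponent `2 - 1 / (2 d)`.

The proof uses generators instead of clocks.

* *Finite graphs.* Along the transitions, the configurations increase in a partial order, so the
  chains converge (`exists_tendsto_exp_of_le`, `exists_isPCFFinalLaw`).
* *Consistency.* The restriction of PCF to a retract of the graph is a Markov chain, namely PCF on
  the retract (`IsRetraction.pcfGenerator_mulVec_comp`). A finite subtree `A` with the root is a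
  retract of each larger finite set, so the law of the final edges of `A` is the same in all of
  them. The measure exists as a limit point of the finite-volume laws (`exists_isPCFMeasure`).
* *Explicit probabilities.* On a finite tree, the probability that finally all edges are open is a
  harmonic function of the configuration; from configurations without frozen vertices it depends on
  the number of closed edges only (`pcfGenerator_mulVec_allOpenHarmonic`). This gives the product
  `allOpenProb`, a moment of the above weight, and by inclusion and exclusion an integral formula
  for the probability of each root cluster (`IsPCFMeasure.real_openClosedEvent`,
  `openClosedProb_eq_integral`).
* *Counting.* All clusters with `k` vertices have the same probability, and their number is given by
  the Fuss-Catalan formula (`card_rootedSubtrees`).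
* *Asymptotics.* After normalisation by the maximum of `q * (1 - q) ^ (d - 1)`, Stirling's formula
  contributes `k ^ (-3 / 2)` (`tendsto_card_rootedSubtrees`), and Laplace's method applied to the
  integral contributes `k ^ (-(1 - b) / 2)`, where the weight behaves like a power `-b` at the
  point `q = 1 / d` (`tendsto_laplace`, `IsPCFMeasure.exists_isEquivalent`). If `α > d - 1`, the
  normalised integrand is bounded away from `1`.
-/

/-! ### Exponentials of generators of finite Markov chains -/

section MatrixExp

open scoped Matrix Nat

variable {n m : Type*} [Fintype n] [DecidableEq n] [Fintype m] [DecidableEq m]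

/-- The exponential series of a real matrix. -/
theorem matrix_hasSum_exp (A : Matrix n n ℝ) :
    HasSum (fun k : ℕ => ((k ! : ℝ)⁻¹) • A ^ k) (NormedSpace.exp A) := by
  let : NormedRing (Matrix n n ℝ) := Matrix.linftyOpNormedRing
  let : NormedAlgebra ℝ (Matrix n n ℝ) := Matrix.linftyOpNormedAlgebra
  exact NormedSpace.exp_series_hasSum_exp' (𝕂 := ℝ) A

theorem matrix_hasSum_exp_mulVec (A : Matrix n n ℝ) (t : ℝ) (f : n → ℝ) (x : n) :
    HasSum (fun k : ℕ => ((k ! : ℝ)⁻¹) * t ^ k * (A ^ k *ᵥ f) x)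
      ((NormedSpace.exp (t • A) *ᵥ f) x) := by
  have hc : Continuous fun B : Matrix n n ℝ => (B *ᵥ f) x :=
    (continuous_apply x).comp (Continuous.matrix_mulVec continuous_id continuous_const)
  have h := (matrix_hasSum_exp (t • A)).map (⟨⟨fun B : Matrix n n ℝ => (B *ᵥ f) x, by simp⟩,
    fun A B => by simp [Matrix.add_mulVec]⟩ : Matrix n n ℝ →+ ℝ) hc
  refine h.congr_fun fun k => ?_
  simp [smul_pow, Matrix.smul_mulVec, mul_assoc]

theorem exp_smul_add (A : Matrix n n ℝ) (s t : ℝ) :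
    NormedSpace.exp ((s + t) • A) = NormedSpace.exp (s • A) * NormedSpace.exp (t • A) := by
  rw [add_smul]
  exact Matrix.exp_add_of_commute _ _ (((Commute.refl A).smul_left s).smul_right t)

/-- If `A` acts on the functions of `π x` as `B` acts on functions (strong lumpability), then so
do the exponentials. -/
theorem exp_mulVec_comp {A : Matrix n n ℝ} {B : Matrix m m ℝ} {π : n → m}
    (h : ∀ g : m → ℝ, A *ᵥ (g ∘ π) = (B *ᵥ g) ∘ π) (t : ℝ) (g : m → ℝ) (x : n) :
    (NormedSpace.exp (t • A) *ᵥ (g ∘ π)) x = (NormedSpace.exp (t • B) *ᵥ g) (π x) := by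
  have hk : ∀ k : ℕ, A ^ k *ᵥ (g ∘ π) = (B ^ k *ᵥ g) ∘ π := by
    intro k
    induction k with
    | zero => simp
    | succ k ih => rw [pow_succ', pow_succ', ← Matrix.mulVec_mulVec, ih, h, Matrix.mulVec_mulVec]
  refine (matrix_hasSum_exp_mulVec A t _ x).unique ?_
  simpa only [hk, Function.comp_apply] using matrix_hasSum_exp_mulVec B t g (π x)

/-- If no transition leaves `R` and `A *ᵥ f` vanishes on `R`, then `f` is invariant on `R`. -/
theorem exp_mulVec_eq_of_closed {A : Matrix n n ℝ} {R : Set n}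
    (hR : ∀ x ∈ R, ∀ y ∉ R, A x y = 0) {f : n → ℝ} (hf : ∀ x ∈ R, (A *ᵥ f) x = 0)
    (t : ℝ) {x : n} (hx : x ∈ R) : (NormedSpace.exp (t • A) *ᵥ f) x = f x := by
  have hk : ∀ k : ℕ, ∀ x ∈ R, (A ^ (k + 1) *ᵥ f) x = 0 := by
    intro k
    induction k with
    | zero => simpa using hf
    | succ k ih =>
      intro x hx
      rw [pow_succ', ← Matrix.mulVec_mulVec, Matrix.mulVec, dotProduct]
      refine Finset.sum_eq_zero fun y _ => ?_
      by_cases hy : y ∈ R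
      · rw [ih y hy, mul_zero]
      · rw [hR x hx y hy, zero_mul]
  refine (matrix_hasSum_exp_mulVec A t f x).unique ?_
  convert hasSum_single (f := fun k : ℕ => ((k ! : ℝ)⁻¹) * t ^ k * (A ^ k *ᵥ f) x) 0 ?_ using 1
  · simp
  · intro k hk0
    obtain ⟨j, rfl⟩ := Nat.exists_eq_succ_of_ne_zero hk0
    simp [hk j x hx]

theorem exp_mulVec_of_eigen {A : Matrix n n ℝ} {f : n → ℝ} {c : ℝ} (h : A *ᵥ f = c • f)
    (t : ℝ) : NormedSpace.exp (t • A) *ᵥ f = Real.exp (t * c) • f := by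
  have hk : ∀ k : ℕ, A ^ k *ᵥ f = c ^ k • f := by
    intro k
    induction k with
    | zero => simp
    | succ k ih =>
      rw [pow_succ', ← Matrix.mulVec_mulVec, ih, Matrix.mulVec_smul, h, smul_smul, pow_succ]
  funext x
  refine (matrix_hasSum_exp_mulVec A t f x).unique ?_
  have h1 : HasSum (fun k : ℕ => (t * c) ^ k / k !) (Real.exp (t * c)) := by
    rw [Real.exp_eq_exp_ℝ]
    exact NormedSpace.expSeries_div_hasSum_exp (t * c)
  refine (h1.mul_right (f x)).congr_fun fun k => ?_
  simp [hk, mul_pow, div_eq_mul_inv]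
  ring

theorem exp_smul_nonneg {A : Matrix n n ℝ} (hA : ∀ x y, x ≠ y → 0 ≤ A x y) {t : ℝ} (ht : 0 ≤ t)
    (x y : n) : 0 ≤ NormedSpace.exp (t • A) x y := by
  -- adding a multiple of the identity makes all the entries nonnegative
  set c : ℝ := ∑ z, |A z z| with hc
  have hB : ∀ x y, 0 ≤ (A + c • (1 : Matrix n n ℝ)) x y := by
    intro x y
    by_cases hxy : x = y
    · subst hxy
      have : |A x x| ≤ c := Finset.single_le_sum (f := fun z => |A z z|)
        (fun _ _ => abs_nonneg _) (Finset.mem_univ x)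
      simp only [Matrix.add_apply, Matrix.smul_apply, Matrix.one_apply_eq, smul_eq_mul, mul_one]
      linarith [neg_abs_le (A x x)]
    · simpa [Matrix.one_apply_ne hxy] using hA x y hxy
  have hBk : ∀ k : ℕ, ∀ x y, 0 ≤ ((A + c • (1 : Matrix n n ℝ)) ^ k) x y := by
    intro k
    induction k with
    | zero => intro x y; simp only [pow_zero, Matrix.one_apply]; split_ifs <;> norm_num
    | succ k ih =>
      intro x y
      rw [pow_succ, Matrix.mul_apply]
      exact Finset.sum_nonneg fun z _ => mul_nonneg (ih x z) (hB z y)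
  have hBe : 0 ≤ NormedSpace.exp (t • (A + c • (1 : Matrix n n ℝ))) x y := by
    have h := matrix_hasSum_exp_mulVec (A + c • (1 : Matrix n n ℝ)) t (Pi.single y 1) x
    simp only [Matrix.mulVec_single_one, Matrix.col_apply] at h
    exact h.nonneg fun k => mul_nonneg (by positivity) (hBk k x y)
  have hsplit : t • A = t • (A + c • (1 : Matrix n n ℝ)) + (-(t * c)) • (1 : Matrix n n ℝ) := by
    rw [smul_add, smul_smul, neg_smul, add_neg_cancel_right]
  have hone : NormedSpace.exp ((-(t * c)) • (1 : Matrix n n ℝ))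
      = Real.exp (-(t * c)) • (1 : Matrix n n ℝ) := by
    ext x y
    have := congrFun (exp_mulVec_of_eigen (A := (1 : Matrix n n ℝ)) (f := Pi.single y 1) (c := 1)
      (by rw [Matrix.one_mulVec, one_smul]) (-(t * c))) x
    simpa [Matrix.one_apply, Pi.single_apply] using this
  rw [hsplit, Matrix.exp_add_of_commute _ _ ((Commute.one_right _).smul_right _), hone]
  simpa using mul_nonneg (Real.exp_pos _).le hBe

theorem exp_smul_row_sum {A : Matrix n n ℝ} (hA : ∀ x, ∑ y, A x y = 0) (t : ℝ) (x : n) :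
    ∑ y, NormedSpace.exp (t • A) x y = 1 := by
  have h : A *ᵥ (fun _ => (1 : ℝ)) = (0 : ℝ) • fun _ => 1 := by
    funext x
    simp [Matrix.mulVec, dotProduct, hA]
  simpa [Matrix.mulVec, dotProduct] using congrFun (exp_mulVec_of_eigen h t) x

/-- The probability of a set that cannot be entered is nonincreasing in time. -/
theorem antitoneOn_sum_exp {A : Matrix n n ℝ} (hA : ∀ x y, x ≠ y → 0 ≤ A x y)
    (hA0 : ∀ x, ∑ y, A x y = 0) (D : Finset n) (hD : ∀ x ∉ D, ∀ y ∈ D, A x y = 0) (z : n) :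
    AntitoneOn (fun t : ℝ => ∑ y ∈ D, NormedSpace.exp (t • A) z y) (Set.Ici 0) := by
  intro s hs t _ hst
  obtain ⟨r, hr, rfl⟩ : ∃ r, 0 ≤ r ∧ t = s + r := ⟨t - s, by linarith, by ring⟩
  have hout : ∀ x ∉ D, ∀ y ∈ D, NormedSpace.exp (r • A) x y = 0 := by
    intro x hx y hy
    have h := exp_mulVec_eq_of_closed (A := A) (R := {x | x ∉ D}) (f := Pi.single y 1)
      (fun x hx y hy => hD x hx y (by simpa using hy))
      (fun x hx => by simpa using hD x hx y hy) r hx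
    have hne : x ≠ y := fun h => hx (h ▸ hy)
    simpa [Pi.single_apply, hne] using h
  calc ∑ y ∈ D, NormedSpace.exp ((s + r) • A) z y
      = ∑ x, NormedSpace.exp (s • A) z x * ∑ y ∈ D, NormedSpace.exp (r • A) x y := by
        simp_rw [exp_smul_add, Matrix.mul_apply, Finset.mul_sum]
        exact Finset.sum_comm
    _ = ∑ x ∈ D, NormedSpace.exp (s • A) z x * ∑ y ∈ D, NormedSpace.exp (r • A) x y := by
        refine (Finset.sum_subset (Finset.subset_univ D) fun x _ hx => ?_).symm
        rw [Finset.sum_eq_zero fun y hy => hout x hx y hy, mul_zero]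
    _ ≤ ∑ x ∈ D, NormedSpace.exp (s • A) z x * 1 := by
        refine Finset.sum_le_sum fun x _ =>
          mul_le_mul_of_nonneg_left ?_ (exp_smul_nonneg hA hs _ _)
        rw [← exp_smul_row_sum hA0 r x]
        exact Finset.sum_le_univ_sum_of_nonneg fun y => exp_smul_nonneg hA hr _ _
    _ = _ := by simp

theorem exists_tendsto_of_antitoneOn_Ici {f : ℝ → ℝ} (hf : AntitoneOn f (Set.Ici 0))
    (h0 : ∀ t, 0 ≤ t → 0 ≤ f t) : ∃ l, Tendsto f atTop (𝓝 l) := by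
  have hanti : Antitone fun t : ℝ => f (max t 0) := fun s t hst =>
    hf (le_max_right s 0) (le_max_right t 0) (max_le_max_right 0 hst)
  refine ⟨_, (tendsto_atTop_ciInf hanti ⟨0, ?_⟩).congr' ?_⟩
  · rintro _ ⟨t, rfl⟩
    exact h0 _ (le_max_right t 0)
  · filter_upwards [eventually_ge_atTop (0 : ℝ)] with t ht
    rw [max_eq_left ht]

/-- A finite continuous-time chain whose transitions all increase a partial order converges. -/
theorem exists_tendsto_exp_of_le {A : Matrix n n ℝ} (hA : ∀ x y, x ≠ y → 0 ≤ A x y)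
    (hA0 : ∀ x, ∑ y, A x y = 0) (le : n → n → Prop) (hrefl : ∀ x, le x x)
    (htrans : ∀ x y z, le x y → le y z → le x z) (hanti : ∀ x y, le x y → le y x → x = y)
    (hle : ∀ x y, A x y ≠ 0 → le x y) (z y : n) :
    ∃ l, Tendsto (fun t : ℝ => NormedSpace.exp (t • A) z y) atTop (𝓝 l) := by
  have key : ∀ D : Finset n, (∀ x ∉ D, ∀ y ∈ D, A x y = 0) →
      ∃ l, Tendsto (fun t : ℝ => ∑ y ∈ D, NormedSpace.exp (t • A) z y) atTop (𝓝 l) :=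
    fun D hD => exists_tendsto_of_antitoneOn_Ici (antitoneOn_sum_exp hA hA0 D hD z)
      fun t ht => Finset.sum_nonneg fun x _ => exp_smul_nonneg hA ht _ _
  -- both the set of states below `y` and this set without `y` cannot be entered
  obtain ⟨l₁, h₁⟩ := key (Finset.univ.filter fun x => le x y) fun x hx w hw => by
    by_contra hne
    simp only [Finset.mem_filter, Finset.mem_univ, true_and] at hx hw
    exact hx (htrans _ _ _ (hle _ _ hne) hw)
  obtain ⟨l₂, h₂⟩ := key ((Finset.univ.filter fun x => le x y).erase y) fun x hx w hw => by
    by_contra hne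
    simp only [Finset.mem_erase, Finset.mem_filter, Finset.mem_univ, true_and] at hx hw
    refine hx ⟨fun hxy => ?_, htrans _ _ _ (hle _ _ hne) hw.2⟩
    subst hxy
    exact hw.1 (hanti _ _ hw.2 (hle _ _ hne))
  refine ⟨l₁ - l₂, (h₁.sub h₂).congr fun t => ?_⟩
  rw [← Finset.add_sum_erase _ (fun w => NormedSpace.exp (t • A) z w)
    (show y ∈ Finset.univ.filter fun x => le x y by simp [hrefl])]
  ring

end MatrixExp

/-! ### The generator of percolation with constant freezing -/

section Generator

open scoped Matrix

variable {V : Type*} [Finite V] {G : SimpleGraph V} {α : ℝ}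

theorem pcfRate_nonneg (hα : 0 ≤ α) (η θ : PCFConfig G) : 0 ≤ pcfRate G α η θ := by
  refine add_nonneg (finsum_nonneg fun e => ?_) (finsum_nonneg fun C => ?_) <;> split_ifs <;>
    first | exact hα | norm_num

theorem pcfGenerator_nonneg (hα : 0 ≤ α) (η θ : PCFConfig G) (h : η ≠ θ) :
    0 ≤ pcfGenerator G α η θ := by
  simpa [pcfGenerator, h] using pcfRate_nonneg hα η θ

/-- The generator acts on a function by summing its increments over the possible transitions. -/
theorem pcfGenerator_mulVec (f : PCFConfig G → ℝ) (η : PCFConfig G) [Fintype G.edgeSet]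
    [Fintype (openGraph η.2).ConnectedComponent] :
    (pcfGenerator G α *ᵥ f) η =
      (∑ e : G.edgeSet,
        if ∀ v ∈ (e : Sym2 V), η.1 v = true then f (openEdge η e) - f η else 0) +
      ∑ C : (openGraph η.2).ConnectedComponent, α * (f (freezeSet η C.supp) - f η) := by
  have h1 : (pcfGenerator G α *ᵥ f) η = ∑ θ, pcfRate G α η θ * (f θ - f η) := by
    simp only [pcfGenerator, Matrix.mulVec, dotProduct, Matrix.of_apply, sub_mul, mul_sub,
      Finset.sum_sub_distrib, ite_mul, zero_mul, Finset.sum_ite_eq, Finset.mem_univ, if_true,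
      Finset.sum_mul]
  rw [h1]
  simp only [pcfRate, finsum_eq_sum_of_fintype, add_mul, Finset.sum_add_distrib, Finset.sum_mul]
  congr 1
  · rw [Finset.sum_comm]
    refine Finset.sum_congr rfl fun e _ => ?_
    rw [Finset.sum_eq_single (openEdge η e)]
    · simp
    · intro θ _ hθ
      simp [hθ]
    · simp
  · rw [Finset.sum_comm]
    refine Finset.sum_congr rfl fun C _ => ?_
    rw [Finset.sum_eq_single (freezeSet η C.supp)]
    · simp
    · intro θ _ hθ
      simp [hθ]
    · simp

theorem pcfGenerator_row_sum (η : PCFConfig G) : ∑ θ, pcfGenerator G α η θ = 0 := by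
  simp [pcfGenerator, Finset.sum_sub_distrib]

theorem transition_of_pcfGenerator_ne_zero {η θ : PCFConfig G} (h : pcfGenerator G α η θ ≠ 0) :
    η = θ ∨ (∃ e : G.edgeSet, (∀ v ∈ (e : Sym2 V), η.1 v = true) ∧ θ = openEdge η e) ∨
      ∃ C : (openGraph η.2).ConnectedComponent, θ = freezeSet η C.supp := by
  by_contra! hcon
  obtain ⟨h1, h2, h3⟩ := hcon
  refine h ?_
  have ha : ∀ e : G.edgeSet,
      ¬ ((∀ v ∈ (e : Sym2 V), η.1 v = true) ∧ θ = openEdge η e) := fun e he => h2 e he.1 he.2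
  simp [pcfGenerator, pcfRate, h1, ha, h3]

theorem pcfLaw_nonneg (hα : 0 ≤ α) {t : ℝ} (ht : 0 ≤ t) (η : PCFConfig G) :
    0 ≤ pcfLaw G α t η :=
  exp_smul_nonneg (pcfGenerator_nonneg hα) ht _ _

theorem exists_isPCFFinalLaw (G : SimpleGraph V) (hα : 0 ≤ α) :
    ∃ ν : PCFConfig G → ℝ, IsPCFFinalLaw G α ν := by
  have h : ∀ η, ∃ l, Tendsto (fun t : ℝ => pcfLaw G α t η) atTop (𝓝 l) := by
    intro η
    -- along the transitions, vertices only freeze and edges only open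
    refine exists_tendsto_exp_of_le (pcfGenerator_nonneg hα) pcfGenerator_row_sum
      (fun η θ => (∀ v, θ.1 v ≤ η.1 v) ∧ ∀ e, η.2 e ≤ θ.2 e) (fun η => ⟨fun _ => le_rfl,
      fun _ => le_rfl⟩) (fun η θ ξ h1 h2 => ⟨fun v => (h2.1 v).trans (h1.1 v),
      fun e => (h1.2 e).trans (h2.2 e)⟩) (fun η θ h1 h2 => Prod.ext
      (funext fun v => le_antisymm (h2.1 v) (h1.1 v))
      (funext fun e => le_antisymm (h1.2 e) (h2.2 e))) (fun η θ h => ?_) _ _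
    rcases transition_of_pcfGenerator_ne_zero h with rfl | ⟨e, -, rfl⟩ | ⟨C, rfl⟩
    · exact ⟨fun _ => le_rfl, fun _ => le_rfl⟩
    · refine ⟨fun _ => le_rfl, fun e' => ?_⟩
      simp only [openEdge]
      split_ifs
      · exact Bool.le_true _
      · exact le_rfl
    · refine ⟨fun v => ?_, fun _ => le_rfl⟩
      simp only [freezeSet]
      split_ifs
      · exact Bool.false_le _
      · exact le_rfl
  choose ν hν using h
  exact ⟨ν, hν⟩

namespace IsPCFFinalLaw

variable {ν : PCFConfig G → ℝ}

theorem nonneg (h : IsPCFFinalLaw G α ν) (hα : 0 ≤ α) (η : PCFConfig G) : 0 ≤ ν η :=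
  ge_of_tendsto (h η) ((eventually_ge_atTop 0).mono fun _ ht => pcfLaw_nonneg hα ht η)

theorem tendsto_sum (h : IsPCFFinalLaw G α ν) (f : PCFConfig G → ℝ) :
    Tendsto (fun t : ℝ => (NormedSpace.exp (t • pcfGenerator G α) *ᵥ f) (pcfInit G)) atTop
      (𝓝 (∑ η, ν η * f η)) :=
  tendsto_finsetSum _ fun η _ => (h η).mul_const (f η)

theorem sum_eq_one (h : IsPCFFinalLaw G α ν) : ∑ η, ν η = 1 := by
  have h1 := h.tendsto_sum fun _ => 1
  simp only [mul_one] at h1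
  refine tendsto_nhds_unique h1 (tendsto_const_nhds.congr fun t => ?_)
  simpa [Matrix.mulVec, dotProduct] using
    (exp_smul_row_sum (pcfGenerator_row_sum (G := G) (α := α)) t (pcfInit G)).symm

/-- In the final configuration every vertex is frozen: a vertex freezes at rate `α`, whatever its
cluster is. -/
theorem eq_zero_of_warm (h : IsPCFFinalLaw G α ν) (hα : 0 < α) {η : PCFConfig G} {v : V}
    (hv : η.1 v = true) : ν η = 0 := by
  let f : PCFConfig G → ℝ := fun η => if η.1 v = true then 1 else 0
  have hf : pcfGenerator G α *ᵥ f = (-α) • f := by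
    funext η
    have := Fintype.ofFinite G.edgeSet
    have := Fintype.ofFinite (openGraph η.2).ConnectedComponent
    rw [pcfGenerator_mulVec, Finset.sum_eq_zero (fun e _ => by simp [f, openEdge]), zero_add,
      Finset.sum_eq_single ((openGraph η.2).connectedComponentMk v)]
    · simp only [f, freezeSet, SimpleGraph.ConnectedComponent.mem_supp_iff, Pi.smul_apply,
        smul_eq_mul]
      split_ifs <;> simp_all
    · intro C _ hC
      simp [f, freezeSet, hC.symm]
    · simp
  have hlim := h.tendsto_sum f
  have h0 : ∑ η, ν η * f η = 0 := by
    refine tendsto_nhds_unique hlim ?_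
    have he : Tendsto (fun t : ℝ => Real.exp (t * -α)) atTop (𝓝 0) :=
      Real.tendsto_exp_atBot.comp (tendsto_id.atTop_mul_const_of_neg (by linarith))
    refine he.congr fun t => ?_
    rw [exp_mulVec_of_eigen hf]
    simp [f, pcfInit]
  have hη := (Finset.sum_eq_zero_iff_of_nonneg fun η _ =>
    mul_nonneg (h.nonneg hα.le η) (by simp only [f]; split_ifs <;> norm_num)).1 h0 η
    (Finset.mem_univ _)
  simpa [f, hv] using hη

end IsPCFFinalLaw

end Generator

/-! ### Restriction to a retract -/

section Retract

open scoped Matrix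

variable {V V₀ : Type*} {G : SimpleGraph V} {G₀ : SimpleGraph V₀}

/-- The restriction of a configuration to an induced subgraph. -/
def restrictConfig (ι : G₀ ↪g G) (η : PCFConfig G) : PCFConfig G₀ :=
  (fun v => η.1 (ι v), fun e => η.2 (ι.mapEdgeSet e))

variable (ι : G₀ ↪g G)

/-- A walk of open edges in the subgraph is one in the whole graph. -/
def restrictConfigHom (η : PCFConfig G) : openGraph (restrictConfig ι η).2 →g openGraph η.2 where
  toFun := ι
  map_rel' := by
    rintro u v ⟨h, hσ⟩
    exact ⟨ι.map_rel_iff.2 h, hσ⟩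

/-- A retraction of the vertices is a retraction of a graph onto an induced subgraph if each edge
either lies in the subgraph or is contracted. -/
structure IsRetraction (ι : G₀ ↪g G) (ρ : V → V₀) : Prop where
  apply_embedding : ∀ v, ρ (ι v) = v
  adj : ∀ a b, G.Adj a b → ρ a = ρ b ∨ (a = ι (ρ a) ∧ b = ι (ρ b))

variable {ι} {ρ : V → V₀}

theorem IsRetraction.reachable (h : IsRetraction ι ρ) {η : PCFConfig G} {a b : V}
    (hab : (openGraph η.2).Reachable a b) :
    (openGraph (restrictConfig ι η).2).Reachable (ρ a) (ρ b) := by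
  obtain ⟨p⟩ := hab
  induction p with
  | nil => rfl
  | @cons a c b hac _ ih =>
    refine SimpleGraph.Reachable.trans ?_ ih
    obtain ⟨hadj, hσ⟩ := hac
    rcases h.adj a c hadj with heq | ⟨ha, hc⟩
    · rw [heq]
    · refine SimpleGraph.Adj.reachable ⟨ι.map_rel_iff.1 (ha ▸ hc ▸ hadj), ?_⟩
      have hedge : ι.mapEdgeSet ⟨s(ρ a, ρ c), ι.map_rel_iff.1 (ha ▸ hc ▸ hadj)⟩ =
          (⟨s(a, c), hadj⟩ : G.edgeSet) := by
        apply Subtype.ext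
        change s(ι (ρ a), ι (ρ c)) = s(a, c)
        rw [← ha, ← hc]
      simpa only [restrictConfig, hedge] using hσ

theorem restrictConfig_openEdge (η : PCFConfig G) (e : G₀.edgeSet) :
    restrictConfig ι (openEdge η (ι.mapEdgeSet e)) = openEdge (restrictConfig ι η) e := by
  simp only [restrictConfig, openEdge, ι.mapEdgeSet.injective.eq_iff]

theorem restrictConfig_openEdge_of_notMem (η : PCFConfig G) {e : G.edgeSet}
    (he : e ∉ Set.range ι.mapEdgeSet) :
    restrictConfig ι (openEdge η e) = restrictConfig ι η := by
  have : ∀ e₀, ι.mapEdgeSet e₀ ≠ e := fun e₀ h => he ⟨e₀, h⟩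
  simp only [restrictConfig, openEdge, this, if_false]

theorem restrictConfig_freezeSet (η : PCFConfig G) (C : Set V) :
    restrictConfig ι (freezeSet η C) = freezeSet (restrictConfig ι η) (ι ⁻¹' C) := rfl

theorem freezeSet_empty (η : PCFConfig G) : freezeSet η ∅ = η := by
  simp [freezeSet]

/-- A cluster meets the image of a retraction in at most one cluster of the restricted
configuration. -/
theorem IsRetraction.preimage_supp_map (h : IsRetraction ι ρ) (η : PCFConfig G)
    (C : (openGraph (restrictConfig ι η).2).ConnectedComponent) :
    ι ⁻¹' (C.map (restrictConfigHom ι η)).supp = C.supp := by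
  induction C using SimpleGraph.ConnectedComponent.ind with
  | _ v =>
    ext w
    simp only [Set.mem_preimage, SimpleGraph.ConnectedComponent.map_mk,
      SimpleGraph.ConnectedComponent.mem_supp_iff, SimpleGraph.ConnectedComponent.eq]
    refine ⟨fun hw => ?_, fun hw => hw.map (restrictConfigHom ι η)⟩
    simpa only [h.apply_embedding, restrictConfigHom, RelHom.coeFn_mk] using h.reachable hw

/-- The restriction of percolation with constant freezing to a retract is percolation with
constant freezing on the retract. -/
theorem IsRetraction.pcfGenerator_mulVec_comp [Finite V] [Finite V₀] (h : IsRetraction ι ρ)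
    (α : ℝ) (g : PCFConfig G₀ → ℝ) :
    pcfGenerator G α *ᵥ (g ∘ restrictConfig ι) =
      (pcfGenerator G₀ α *ᵥ g) ∘ restrictConfig ι := by
  funext η
  have := Fintype.ofFinite G.edgeSet
  have := Fintype.ofFinite G₀.edgeSet
  have := Fintype.ofFinite (openGraph η.2).ConnectedComponent
  have := Fintype.ofFinite (openGraph (restrictConfig ι η).2).ConnectedComponent
  rw [Function.comp_apply, pcfGenerator_mulVec, pcfGenerator_mulVec]
  congr 1
  · refine (Fintype.sum_of_injective ι.mapEdgeSet ι.mapEdgeSet.injective _ _ ?_ ?_).symm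
    · intro e he
      simp [restrictConfig_openEdge_of_notMem η he]
    · intro e
      have hw : (∀ v ∈ (ι.mapEdgeSet e : Sym2 V), η.1 v = true) ↔
          ∀ v ∈ (e : Sym2 V₀), (restrictConfig ι η).1 v = true := by
        change (∀ v ∈ Sym2.map ι (e : Sym2 V₀), η.1 v = true) ↔ _
        simp [restrictConfig, Sym2.mem_map]
      simp only [hw, restrictConfig_openEdge, Function.comp_apply]
  · have hinj : Function.Injective
        fun C : (openGraph (restrictConfig ι η).2).ConnectedComponent =>
          C.map (restrictConfigHom ι η) := by
      intro C D hCD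
      have := congrArg (fun E => ι ⁻¹' SimpleGraph.ConnectedComponent.supp E) hCD
      simp only [h.preimage_supp_map] at this
      exact SimpleGraph.ConnectedComponent.supp_injective this
    refine (Fintype.sum_of_injective _ hinj _ _ ?_ ?_).symm
    · intro C hC
      have hempty : ι ⁻¹' C.supp = ∅ := by
        refine Set.eq_empty_of_forall_notMem fun v hv =>
          hC ⟨(openGraph _).connectedComponentMk v, ?_⟩
        simpa [restrictConfigHom] using hv
      simp [restrictConfig_freezeSet, hempty, freezeSet_empty]
    · intro C
      simp only [Function.comp_apply, restrictConfig_freezeSet, h.preimage_supp_map]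

theorem IsRetraction.sum_final [Finite V] [Finite V₀] (h : IsRetraction ι ρ) {α : ℝ}
    {ν : PCFConfig G → ℝ} {ν₀ : PCFConfig G₀ → ℝ} (hν : IsPCFFinalLaw G α ν)
    (hν₀ : IsPCFFinalLaw G₀ α ν₀) (g : PCFConfig G₀ → ℝ) :
    ∑ η, ν η * g (restrictConfig ι η) = ∑ η, ν₀ η * g η := by
  refine tendsto_nhds_unique (hν.tendsto_sum (g ∘ restrictConfig ι))
    ((hν₀.tendsto_sum g).congr fun t => ?_)
  rw [exp_mulVec_comp (h.pcfGenerator_mulVec_comp α)]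
  rfl

end Retract

/-! ### The probability that all the edges of a finite tree are open -/

section AllOpen

open scoped Matrix

/-- The probability that all the edges of a finite tree with `n` edges are finally open; it does
not depend on the shape of the tree. -/
noncomputable def allOpenProb (α : ℝ) (n : ℕ) : ℝ :=
  ∏ i ∈ Finset.range n, ((i : ℝ) + 1) / ((i : ℝ) + 1 + α * ((i : ℝ) + 2))

theorem allOpenProb_zero (α : ℝ) : allOpenProb α 0 = 1 := by simp [allOpenProb]

theorem allOpenProb_succ {α : ℝ} (hα : 0 ≤ α) (n : ℕ) :
    ((n : ℝ) + 1 + α * ((n : ℝ) + 2)) * allOpenProb α (n + 1) =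
      ((n : ℝ) + 1) * allOpenProb α n := by
  have : (n : ℝ) + 1 + α * ((n : ℝ) + 2) ≠ 0 := by positivity
  rw [allOpenProb, Finset.prod_range_succ, ← allOpenProb]
  field_simp

variable {V : Type*} {G : SimpleGraph V}

/-- The configurations in which the ends of each open edge are in the same state. -/
def consistentConfigs (G : SimpleGraph V) : Set (PCFConfig G) :=
  {η | ∀ u v, (openGraph η.2).Adj u v → η.1 u = η.1 v}

theorem openEdge_mem_consistentConfigs {η : PCFConfig G} (hη : η ∈ consistentConfigs G)
    {e : G.edgeSet} (he : ∀ v ∈ (e : Sym2 V), η.1 v = true) :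
    openEdge η e ∈ consistentConfigs G := by
  rintro u v ⟨h, hσ⟩
  change η.1 u = η.1 v
  by_cases heq : (⟨s(u, v), h⟩ : G.edgeSet) = e
  · subst heq
    rw [he u (Sym2.mem_mk_left u v), he v (Sym2.mem_mk_right u v)]
  · exact hη u v ⟨h, by simpa [openEdge, heq] using hσ⟩

theorem freezeSet_mem_consistentConfigs {η : PCFConfig G} (hη : η ∈ consistentConfigs G)
    (C : (openGraph η.2).ConnectedComponent) : freezeSet η C.supp ∈ consistentConfigs G := by
  intro u v h
  have h' : (openGraph η.2).Adj u v := h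
  have hC : u ∈ C.supp ↔ v ∈ C.supp := by
    simp only [SimpleGraph.ConnectedComponent.mem_supp_iff,
      SimpleGraph.ConnectedComponent.sound h'.reachable]
  simp only [freezeSet, hC, hη u v h']

theorem closedEdges_openEdge (η : PCFConfig G) (e : G.edgeSet) :
    {e' | (openEdge η e).2 e' = false} = {e' | η.2 e' = false} \ {e} := by
  ext e'
  by_cases h : e' = e <;> simp [openEdge, h]

/-- The indicator of the event that all edges are open. -/
noncomputable def allOpenIndicator (σ : G.edgeSet → Bool) : ℝ :=
  if ∀ e, σ e = true then 1 else 0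

variable {α : ℝ}

/-- The probability that finally all edges are open, as a function of the initial configuration,
on a finite tree and for consistent configurations. -/
noncomputable def allOpenHarmonic (G : SimpleGraph V) (α : ℝ) (η : PCFConfig G) : ℝ :=
  if ∀ v, η.1 v = true then allOpenProb α {e | η.2 e = false}.ncard
  else allOpenIndicator η.2

theorem allOpenHarmonic_freezeSet (η : PCFConfig G) (C : (openGraph η.2).ConnectedComponent) :
    allOpenHarmonic G α (freezeSet η C.supp) = allOpenIndicator η.2 := by
  have : ¬ ∀ v, (freezeSet η C.supp).1 v = true := by
    obtain ⟨v, hv⟩ := C.nonempty_supp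
    exact fun h => by simpa only [freezeSet, if_pos hv, Bool.false_eq_true] using h v
  rw [allOpenHarmonic, if_neg this]
  rfl

variable [Finite V]

theorem pcfGenerator_mulVec_allOpenHarmonic (hG : G.Connected) (hα : 0 ≤ α)
    (hcomp : ∀ σ : G.edgeSet → Bool,
      Nat.card (openGraph σ).ConnectedComponent = {e | σ e = false}.ncard + 1)
    {η : PCFConfig G} (hη : η ∈ consistentConfigs G) :
    (pcfGenerator G α *ᵥ allOpenHarmonic G α) η = 0 := by
  have := Fintype.ofFinite G.edgeSet
  have := Fintype.ofFinite (openGraph η.2).ConnectedComponent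
  rw [pcfGenerator_mulVec]
  simp only [allOpenHarmonic_freezeSet, Finset.sum_const, Finset.card_univ]
  rw [← Nat.card_eq_fintype_card, hcomp]
  by_cases hw : ∀ v, η.1 v = true
  · -- opening a closed edge lowers the number of closed edges by one
    have hwe : ∀ e : G.edgeSet, ∀ v, (openEdge η e).1 v = true := fun e v => hw v
    have hopen : ∀ e : G.edgeSet, allOpenHarmonic G α (openEdge η e) - allOpenHarmonic G α η =
        if η.2 e = false then allOpenProb α ({e | η.2 e = false}.ncard - 1) -
          allOpenProb α {e | η.2 e = false}.ncard else 0 := by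
      intro e
      rw [allOpenHarmonic, if_pos (hwe e), allOpenHarmonic, if_pos hw, closedEdges_openEdge]
      split_ifs with he
      · rw [Set.ncard_sdiff_singleton_of_mem (show e ∈ {e | η.2 e = false} from he)]
      · rw [Set.sdiff_singleton_eq_self (show e ∉ {e | η.2 e = false} from he), sub_self]
    simp only [hw, implies_true, if_true, hopen]
    rw [← Finset.sum_filter, Finset.sum_const]
    have hcard : (Finset.univ.filter fun e => η.2 e = false).card = {e | η.2 e = false}.ncard := by
      rw [← Set.ncard_coe_finset]
      simp
    rw [hcard, allOpenHarmonic, if_pos hw]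
    rcases Nat.eq_zero_or_pos {e | η.2 e = false}.ncard with h0 | hpos
    · have hall : ∀ e, η.2 e = true := by
        intro e
        rw [Set.ncard_eq_zero] at h0
        by_contra hne
        have : e ∈ {e | η.2 e = false} := by simpa using hne
        rw [h0] at this
        exact this
      rw [h0, allOpenIndicator, if_pos hall, allOpenProb_zero]
      simp
    · have hall : ¬ ∀ e, η.2 e = true := by
        intro hall
        simp [hall] at hpos
      obtain ⟨m, hm⟩ := Nat.exists_eq_succ_of_ne_zero hpos.ne'
      rw [hm, allOpenIndicator, if_neg hall]
      have := allOpenProb_succ hα m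
      simp only [Nat.succ_eq_add_one, add_tsub_cancel_right, nsmul_eq_mul]
      push_cast
      linear_combination -this
  · have hη0 : allOpenHarmonic G α η = allOpenIndicator η.2 := by
      rw [allOpenHarmonic, if_neg hw]
    rw [hη0, sub_self, mul_zero, smul_zero, add_zero]
    refine Finset.sum_eq_zero fun e _ => ?_
    split_ifs with he
    swap
    · rfl
    by_cases hall : ∀ e, η.2 e = true
    · have : openEdge η e = η := Prod.ext rfl (funext fun e' => by simp [openEdge, hall])
      rw [this, hη0, sub_self]
    · rw [allOpenIndicator, if_neg hall, sub_zero, allOpenHarmonic,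
        if_neg (show ¬ ∀ v, (openEdge η e).1 v = true from hw), allOpenIndicator, if_neg]
      -- if only `e` were closed, then all vertices would be in the state of the ends of `e`
      intro hall'
      have hadj : ∀ u v, G.Adj u v → η.1 u = η.1 v := fun u v h =>
        openEdge_mem_consistentConfigs hη he u v ⟨h, hall' _⟩
      refine hw fun v => ?_
      obtain ⟨u, hu⟩ : ∃ u, u ∈ (e : Sym2 V) := by
        induction hx : (e : Sym2 V) with
        | _ a b => exact ⟨a, Sym2.mem_mk_left a b⟩
      obtain ⟨p⟩ := hG.preconnected u v
      have : ∀ {a b : V}, G.Walk a b → η.1 a = η.1 b := by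
        intro a b p
        induction p with
        | nil => rfl
        | cons h _ ih => exact (hadj _ _ h).trans ih
      rw [← this p, he u hu]

theorem IsPCFFinalLaw.sum_allOpen (hG : G.Connected) (hα : 0 < α)
    (hcomp : ∀ σ : G.edgeSet → Bool,
      Nat.card (openGraph σ).ConnectedComponent = {e | σ e = false}.ncard + 1)
    {ν : PCFConfig G → ℝ} (hν : IsPCFFinalLaw G α ν) :
    ∑ η, ν η * allOpenIndicator η.2 = allOpenProb α (Nat.card G.edgeSet) := by
  have hinit : pcfInit G ∈ consistentConfigs G := fun _ _ _ => rfl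
  have hR : ∀ η ∈ consistentConfigs G, ∀ θ ∉ consistentConfigs G, pcfGenerator G α η θ = 0 := by
    intro η hη θ hθ
    by_contra hne
    rcases transition_of_pcfGenerator_ne_zero hne with rfl | ⟨e, he, rfl⟩ | ⟨C, rfl⟩
    · exact hθ hη
    · exact hθ (openEdge_mem_consistentConfigs hη he)
    · exact hθ (freezeSet_mem_consistentConfigs hη C)
  have h1 := hν.tendsto_sum (allOpenHarmonic G α)
  simp only [exp_mulVec_eq_of_closed hR
    (fun η hη => pcfGenerator_mulVec_allOpenHarmonic hG hα.le hcomp hη) _ hinit] at h1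
  have h2 := tendsto_nhds_unique tendsto_const_nhds h1
  have h3 : allOpenHarmonic G α (pcfInit G) = allOpenProb α (Nat.card G.edgeSet) := by
    simp [allOpenHarmonic, pcfInit]
  rw [← h3, h2]
  refine Finset.sum_congr rfl fun η _ => ?_
  by_cases hw : ∀ v, η.1 v = true
  · obtain ⟨v⟩ := hG.nonempty
    rw [hν.eq_zero_of_warm hα (hw v), zero_mul, zero_mul]
  · rw [allOpenHarmonic, if_neg hw]

end AllOpen

/-! ### Finite subtrees of the `d`-ary tree -/

section Subtree

variable {d : ℕ}

theorem daryTree_adj {u v : List (Fin d)} :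
    (daryTree d).Adj u v ↔ (v ≠ [] ∧ v.tail = u) ∨ (u ≠ [] ∧ u.tail = v) := by
  have h : ∀ u v : List (Fin d), (∃ i : Fin d, v = i :: u) ↔ v ≠ [] ∧ v.tail = u := by
    intro u v
    cases v with
    | nil => simp
    | cons j v => simp [eq_comm]
  simp only [daryTree, SimpleGraph.fromRel_adj, h]
  refine ⟨fun hh => hh.2, fun hh => ⟨?_, hh⟩⟩
  rintro rfl
  have : ∀ u : List (Fin d), ¬ (u ≠ [] ∧ u.tail = u) := by
    intro u hu
    have := congrArg List.length hu.2
    have := List.length_pos_iff.2 hu.1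
    simp at *
    omega
  exact hh.elim (this _) (this _)

/-- The edge from the vertex `v` to its parent. -/
def parentEdge (v : List (Fin d)) (hv : v ≠ []) : (daryTree d).edgeSet :=
  ⟨s(v.tail, v), daryTree_adj.2 (Or.inl ⟨hv, rfl⟩)⟩

/-- A set of vertices that contains the root and the parent of each of its elements. -/
structure IsRootedSubtree (A : Finset (List (Fin d))) : Prop where
  nil_mem : [] ∈ A
  tail_mem : ∀ v ∈ A, v.tail ∈ A

/-- The subgraph of the `d`-ary tree induced by a finite set of vertices. -/
abbrev subtreeGraph (A : Finset (List (Fin d))) : SimpleGraph (A : Set (List (Fin d))) :=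
  (daryTree d).induce (A : Set (List (Fin d)))

/-- The first vertex with the property `p` on the way from a vertex (included) to the root, or the
root if there is none. -/
noncomputable def nearestAncestor (p : List (Fin d) → Prop) : List (Fin d) → List (Fin d)
  | [] => []
  | i :: u => if p (i :: u) then i :: u else nearestAncestor p u

theorem nearestAncestor_of_pos {p : List (Fin d) → Prop} {v : List (Fin d)} (h : p v) :
    nearestAncestor p v = v := by
  cases v with
  | nil => rfl
  | cons i u => simp [nearestAncestor, h]

theorem nearestAncestor_of_neg {p : List (Fin d) → Prop} {v : List (Fin d)} (h : ¬ p v) :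
    nearestAncestor p v = nearestAncestor p v.tail := by
  cases v with
  | nil => rfl
  | cons i u => simp [nearestAncestor, h]

theorem nearestAncestor_spec {p : List (Fin d) → Prop} (h : p []) (v : List (Fin d)) :
    p (nearestAncestor p v) := by
  induction v with
  | nil => exact h
  | cons i u ih =>
    by_cases hp : p (i :: u)
    · rwa [nearestAncestor_of_pos hp]
    · rwa [nearestAncestor_of_neg hp]

namespace IsRootedSubtree

variable {A : Finset (List (Fin d))}

/-- A rooted subtree contains the ancestors of its vertices. -/
theorem nearestAncestor_mem (hA : IsRootedSubtree A) (p : List (Fin d) → Prop)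
    {v : List (Fin d)} (hv : v ∈ A) : nearestAncestor p v ∈ A := by
  induction v with
  | nil => exact hv
  | cons i u ih =>
    by_cases hp : p (i :: u)
    · rwa [nearestAncestor_of_pos hp]
    · rw [nearestAncestor_of_neg hp]
      exact ih (hA.tail_mem _ hv)

/-- The edge of the subtree from a vertex other than the root to its parent. -/
def edge (hA : IsRootedSubtree A) (v : {v : (A : Set (List (Fin d))) // v.1 ≠ []}) :
    (subtreeGraph A).edgeSet :=
  ⟨s(⟨v.1.1.tail, hA.tail_mem _ v.1.2⟩, v.1), daryTree_adj.2 (Or.inl ⟨v.2, rfl⟩)⟩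

theorem edge_bijective (hA : IsRootedSubtree A) : Function.Bijective hA.edge := by
  constructor
  · rintro ⟨⟨v, hv⟩, hv0⟩ ⟨⟨w, hw⟩, hw0⟩ h
    have h' : s(v.tail, v) = s(w.tail, w) := by
      have := congrArg (fun e => Sym2.map Subtype.val (Subtype.val e)) h
      simpa [edge] using this
    rw [Sym2.eq_iff] at h'
    rcases h' with h' | ⟨h1, h2⟩
    · simp [h'.2]
    · exfalso
      have h3 := congrArg List.length h1
      have h4 := congrArg List.length h2
      have h5 := List.length_pos_iff.2 hv0
      have h6 := List.length_pos_iff.2 hw0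
      rw [List.length_tail] at h3 h4
      simp only at h5 h6
      omega
  · rintro ⟨e, he⟩
    induction e with
    | _ a b =>
      have hab : (daryTree d).Adj a.1 b.1 := he
      rcases daryTree_adj.1 hab with ⟨h0, h1⟩ | ⟨h0, h1⟩
      · refine ⟨⟨b, h0⟩, Subtype.ext ?_⟩
        obtain ⟨a, ha⟩ := a
        subst h1
        rfl
      · refine ⟨⟨a, h0⟩, Subtype.ext ?_⟩
        obtain ⟨b, hb⟩ := b
        subst h1
        exact Sym2.eq_swap

theorem ncard_ne_nil (hA : IsRootedSubtree A)
    (P : {v : (A : Set (List (Fin d))) // v.1 ≠ []} → Prop) :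
    Nat.card {v : (A : Set (List (Fin d))) // v.1 = [] ∨ ∃ h : v.1 ≠ [], P ⟨v, h⟩} =
      {v | P v}.ncard + 1 := by
  have h1 : {v : (A : Set (List (Fin d))) | v.1 = [] ∨ ∃ h : v.1 ≠ [], P ⟨v, h⟩} =
      insert ⟨[], hA.nil_mem⟩ (Subtype.val '' {v | P v}) := by
    ext v
    refine or_congr (by simp [Subtype.ext_iff]) ⟨?_, ?_⟩
    · rintro ⟨h, hP⟩
      exact ⟨⟨v, h⟩, hP, rfl⟩
    · rintro ⟨w, hP, rfl⟩
      exact ⟨w.2, hP⟩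
  have h2 : Nat.card {v : (A : Set (List (Fin d))) // v.1 = [] ∨ ∃ h : v.1 ≠ [], P ⟨v, h⟩} =
      {v : (A : Set (List (Fin d))) | v.1 = [] ∨ ∃ h : v.1 ≠ [], P ⟨v, h⟩}.ncard := rfl
  rw [h2, h1, Set.ncard_insert_of_notMem, Set.ncard_image_of_injective _ Subtype.val_injective]
  rintro ⟨v, -, hv⟩
  exact v.2 (by rw [hv])

theorem card_edgeSet (hA : IsRootedSubtree A) :
    Nat.card (subtreeGraph A).edgeSet + 1 = A.card := by
  rw [← Nat.card_eq_of_bijective _ hA.edge_bijective]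
  have h := hA.ncard_ne_nil fun _ => True
  rw [Set.ofPred_true, Set.ncard_univ] at h
  have hA' : Nat.card (A : Set (List (Fin d))) = A.card := by simp
  rw [← h, ← hA']
  refine Nat.card_congr (Equiv.subtypeUnivEquiv fun v => ?_)
  simpa using em (v.1 = [])

/-- Each cluster of a finite subtree has a top vertex: the root, or a vertex whose edge to its
parent is closed. -/
theorem card_connectedComponent (hA : IsRootedSubtree A) (σ : (subtreeGraph A).edgeSet → Bool) :
    Nat.card (openGraph σ).ConnectedComponent = {e | σ e = false}.ncard + 1 := by
  have h1 : {e | σ e = false} = hA.edge '' {v | σ (hA.edge v) = false} := by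
    ext e
    obtain ⟨v, rfl⟩ := hA.edge_bijective.2 e
    simp [hA.edge_bijective.1.eq_iff]
  rw [h1, Set.ncard_image_of_injective _ hA.edge_bijective.1, ← hA.ncard_ne_nil]
  symm
  let p : List (Fin d) → Prop := fun v =>
    ∃ hv : v ∈ A, v = [] ∨ ∃ h : v ≠ [], σ (hA.edge ⟨⟨v, hv⟩, h⟩) = false
  have hp0 : p [] := ⟨hA.nil_mem, Or.inl rfl⟩
  have hpar : ∀ (v : List (Fin d)) (hv : v ∈ A), ¬ p v →
      (openGraph σ).Adj ⟨v.tail, hA.tail_mem _ hv⟩ ⟨v, hv⟩ := by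
    intro v hv hp
    have hv0 : v ≠ [] := fun h => hp ⟨hv, Or.inl h⟩
    refine ⟨daryTree_adj.2 (Or.inl ⟨hv0, rfl⟩), ?_⟩
    by_contra hne
    exact hp ⟨hv, Or.inr ⟨hv0, by simpa [edge] using hne⟩⟩
  have hreach : ∀ (v : List (Fin d)) (hv : v ∈ A), (openGraph σ).Reachable
      ⟨nearestAncestor p v, hA.nearestAncestor_mem p hv⟩ ⟨v, hv⟩ := by
    intro v
    induction v with
    | nil => intro hv; rfl
    | cons i u ih =>
      intro hv
      by_cases hp : p (i :: u)
      · simp only [nearestAncestor_of_pos hp]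
        rfl
      · simp only [nearestAncestor_of_neg hp]
        exact (ih (hA.tail_mem _ hv)).trans (hpar _ hv hp).reachable
  have hconst : ∀ a b : (A : Set (List (Fin d))), (openGraph σ).Reachable a b →
      nearestAncestor p a = nearestAncestor p b := by
    have hedge : ∀ (v : List (Fin d)) (hv : v ∈ A),
        (openGraph σ).Adj ⟨v.tail, hA.tail_mem _ hv⟩ ⟨v, hv⟩ → v ≠ [] →
        nearestAncestor p v.tail = nearestAncestor p v := by
      rintro v hv ⟨h, hσ⟩ hv0
      rw [nearestAncestor_of_neg (v := v)]
      rintro ⟨hv', h0 | ⟨h0, hcl⟩⟩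
      · exact hv0 h0
      · have : σ (hA.edge ⟨⟨v, hv⟩, h0⟩) = true := hσ
        rw [this] at hcl
        cases hcl
    rintro a b ⟨w⟩
    induction w with
    | nil => rfl
    | @cons a c b hac _ ih =>
      rw [← ih]
      obtain ⟨a, ha⟩ := a
      obtain ⟨c, hc⟩ := c
      obtain ⟨hadj, hσ⟩ := id hac
      rcases daryTree_adj.1 hadj with ⟨h0, h1⟩ | ⟨h0, h1⟩
      · subst h1
        exact hedge c hc hac h0
      · subst h1
        exact (hedge a ha hac.symm h0).symm
  have hiff : ∀ v : (A : Set (List (Fin d))),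
      (v.1 = [] ∨ ∃ h : v.1 ≠ [], σ (hA.edge ⟨v, h⟩) = false) ↔ p v.1 := fun v =>
    ⟨fun h => ⟨v.2, h⟩, fun ⟨_, h⟩ => h⟩
  refine Nat.card_eq_of_bijective (fun v => (openGraph σ).connectedComponentMk v.1) ⟨?_, ?_⟩
  · rintro ⟨v, hv⟩ ⟨w, hw⟩ h
    have := hconst v w (SimpleGraph.ConnectedComponent.exact h)
    rw [nearestAncestor_of_pos ((hiff v).1 hv), nearestAncestor_of_pos ((hiff w).1 hw)] at this
    exact Subtype.ext (Subtype.ext this)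
  · intro C
    induction C using SimpleGraph.ConnectedComponent.ind with
    | _ v =>
      exact ⟨⟨⟨nearestAncestor p v, hA.nearestAncestor_mem p v.2⟩,
        (hiff _).2 (nearestAncestor_spec hp0 v.1)⟩,
        SimpleGraph.ConnectedComponent.sound (hreach v.1 v.2)⟩

theorem connected (hA : IsRootedSubtree A) : (subtreeGraph A).Connected := by
  have hreach : ∀ (v : List (Fin d)) (hv : v ∈ A),
      (subtreeGraph A).Reachable ⟨[], hA.nil_mem⟩ ⟨v, hv⟩ := by
    intro v
    induction v with
    | nil => intro hv; rfl
    | cons i u ih =>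
      intro hv
      refine (ih (hA.tail_mem _ hv)).trans (SimpleGraph.Adj.reachable ?_)
      exact daryTree_adj.2 (Or.inl ⟨List.cons_ne_nil i u, rfl⟩)
  have : Nonempty (A : Set (List (Fin d))) := ⟨⟨[], hA.nil_mem⟩⟩
  exact ⟨fun v w => (hreach v.1 v.2).symm.trans (hreach w.1 w.2)⟩

/-- The projection of the vertices to the nearest ancestors in a rooted subtree is a retraction. -/
theorem isRetraction (hA : IsRootedSubtree A) {S : Finset (List (Fin d))}
    (hS : (A : Set (List (Fin d))) ⊆ S) :
    IsRetraction (SimpleGraph.induceHomOfLE (daryTree d) hS)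
      (fun v : (S : Set (List (Fin d))) =>
        (⟨nearestAncestor (· ∈ A) v.1, nearestAncestor_spec hA.nil_mem v.1⟩ :
          (A : Set (List (Fin d))))) where
  apply_embedding v := Subtype.ext (nearestAncestor_of_pos v.2)
  adj := by
    have key : ∀ a b : (S : Set (List (Fin d))), b.1.tail = a.1 →
        nearestAncestor (· ∈ A) a.1 = nearestAncestor (· ∈ A) b.1 ∨
          (a.1 ∈ A ∧ b.1 ∈ A) := by
      intro a b hab
      by_cases hb : b.1 ∈ A
      · exact Or.inr ⟨hab ▸ hA.tail_mem _ hb, hb⟩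
      · left
        rw [nearestAncestor_of_neg (v := b.1) hb, hab]
    intro a b hab
    have h : nearestAncestor (· ∈ A) a.1 = nearestAncestor (· ∈ A) b.1 ∨ (a.1 ∈ A ∧ b.1 ∈ A) := by
      rcases daryTree_adj.1 hab with ⟨-, h1⟩ | ⟨-, h1⟩
      · exact key a b h1
      · exact (key b a h1).imp Eq.symm And.symm
    refine h.imp (fun h => Subtype.ext h) fun h => ⟨Subtype.ext ?_, Subtype.ext ?_⟩
    · exact (nearestAncestor_of_pos (p := (· ∈ A)) h.1).symm
    · exact (nearestAncestor_of_pos (p := (· ∈ A)) h.2).symm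

end IsRootedSubtree

end Subtree

/-! ### Existence of the measure on the infinite tree -/

section Existence

theorem extendEdges_apply {V : Type*} {G : SimpleGraph V} {S : Set V}
    (σ : (G.induce S).edgeSet → Bool) {e' : (G.induce S).edgeSet} {e : G.edgeSet}
    (h : Sym2.map Subtype.val (e' : Sym2 S) = (e : Sym2 V)) : extendEdges σ e = σ e' := by
  have : (∃ e'' : (G.induce S).edgeSet,
      Sym2.map Subtype.val (e'' : Sym2 S) = (e : Sym2 V) ∧ σ e'' = true) ↔ σ e' = true := by
    refine ⟨?_, fun hσ => ⟨e', h, hσ⟩⟩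
    rintro ⟨e'', h'', hσ⟩
    have : e'' = e' :=
      Subtype.ext (Sym2.map.injective Subtype.val_injective (h''.trans h.symm))
    rwa [← this]
  rw [extendEdges]
  simp only [this]
  cases σ e' <;> rfl

variable {d : ℕ} {α : ℝ}

/-- The law of the edges of a rooted subtree `A` is the same in all finite sets that contain
`A`. -/
theorem IsRootedSubtree.sum_cylinder {A : Finset (List (Fin d))} (hA : IsRootedSubtree A)
    {S : Finset (List (Fin d))} (hS : A ⊆ S) {ν : PCFConfig (subtreeGraph S) → ℝ}
    {ν₀ : PCFConfig (subtreeGraph A) → ℝ} (hν : IsPCFFinalLaw (subtreeGraph S) α ν)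
    (hν₀ : IsPCFFinalLaw (subtreeGraph A) α ν₀) (F : Finset (daryTree d).edgeSet)
    (hF : ∀ e ∈ F, ∃ e' : (subtreeGraph A).edgeSet,
      Sym2.map Subtype.val (e' : Sym2 (A : Set (List (Fin d)))) = (e : Sym2 (List (Fin d))))
    (ω : (daryTree d).edgeSet → Bool) :
    (∑ η, if ∀ e ∈ F, extendEdges η.2 e = ω e then ν η else 0) =
      ∑ η, if ∀ e ∈ F, extendEdges η.2 e = ω e then ν₀ η else 0 := by
  have hS' : (A : Set (List (Fin d))) ⊆ S := by exact_mod_cast hS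
  have h := (hA.isRetraction hS').sum_final hν hν₀
    (fun η => if ∀ e ∈ F, extendEdges η.2 e = ω e then 1 else 0)
  simp only [mul_ite, mul_one, mul_zero] at h
  rw [← h]
  refine Finset.sum_congr rfl fun η _ => ?_
  have hiff : (∀ e ∈ F, extendEdges η.2 e = ω e) ↔ ∀ e ∈ F, extendEdges
      (restrictConfig (SimpleGraph.induceHomOfLE (daryTree d) hS') η).2 e = ω e := by
    refine forall₂_congr fun e he => ?_
    obtain ⟨e', he'⟩ := hF e he
    rw [extendEdges_apply _ he', extendEdges_apply (e' := (SimpleGraph.induceHomOfLE (daryTree d)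
      hS').mapEdgeSet e') η.2 ?_]
    · rfl
    · rw [← he']
      change Sym2.map Subtype.val (Sym2.map (Set.inclusion hS') _) = _
      rw [Sym2.map_map]
      rfl
  simp only [hiff]

/-- The ball of radius `n` around the root. -/
noncomputable def treeBall (d n : ℕ) : Finset (List (Fin d)) :=
  (List.finite_length_le (Fin d) n).toFinset

theorem mem_treeBall {n : ℕ} {v : List (Fin d)} : v ∈ treeBall d n ↔ v.length ≤ n := by
  simp [treeBall]

theorem isRootedSubtree_treeBall (n : ℕ) : IsRootedSubtree (treeBall d n) where
  nil_mem := by simp [mem_treeBall]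
  tail_mem v hv := by
    rw [mem_treeBall] at *
    simp only [List.length_tail]
    omega

theorem exists_treeBall_edges (F : Finset (daryTree d).edgeSet) :
    ∃ n, ∀ e ∈ F, ∃ e' : (subtreeGraph (treeBall d n)).edgeSet,
      Sym2.map Subtype.val (e' : Sym2 (treeBall d n : Set (List (Fin d)))) =
        (e : Sym2 (List (Fin d))) := by
  have h1 : ∀ e : (daryTree d).edgeSet, ∃ m, ∀ v ∈ (e : Sym2 (List (Fin d))), v.length ≤ m := by
    rintro ⟨e, he⟩
    induction e with
    | _ a b => exact ⟨max a.length b.length, by simp⟩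
  choose m hm using h1
  refine ⟨F.sup m, fun e he => ?_⟩
  have h2 : ∀ v ∈ (e : Sym2 (List (Fin d))), v ∈ treeBall d (F.sup m) := fun v hv =>
    mem_treeBall.2 ((hm e v hv).trans (Finset.le_sup he))
  obtain ⟨e, hadj⟩ := e
  induction e with
  | _ a b =>
    exact ⟨⟨s(⟨a, h2 a (Sym2.mem_mk_left a b)⟩, ⟨b, h2 b (Sym2.mem_mk_right a b)⟩), hadj⟩, rfl⟩

theorem measurableSet_edgeCylinder (F : Finset (daryTree d).edgeSet)
    (ω : (daryTree d).edgeSet → Bool) : 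
    MeasurableSet {σ : (daryTree d).edgeSet → Bool | ∀ e ∈ F, σ e = ω e} := by
  have : {σ : (daryTree d).edgeSet → Bool | ∀ e ∈ F, σ e = ω e} =
      ⋂ e ∈ F, {σ | σ e = ω e} := by
    ext σ; simp
  rw [this]
  exact F.measurableSet_biInter fun e _ =>
    measurableSet_eq_fun (measurable_pi_apply e) measurable_const

theorem isClopen_edgeCylinder (F : Finset (daryTree d).edgeSet)
    (ω : (daryTree d).edgeSet → Bool) :
    IsClopen {σ : (daryTree d).edgeSet → Bool | ∀ e ∈ F, σ e = ω e} := by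
  have : {σ : (daryTree d).edgeSet → Bool | ∀ e ∈ F, σ e = ω e} =
      ⋂ e ∈ F, (fun σ => σ e) ⁻¹' {ω e} := by
    ext σ; simp
  rw [this]
  exact isClopen_biInter_finset fun e _ => (isClopen_discrete _).preimage (continuous_apply e)

/-- The law of the extension by closed edges of the edge configuration in a finite set `S`. -/
noncomputable def finalEdgeMeasure {S : Finset (List (Fin d))}
    (ν : PCFConfig (subtreeGraph S) → ℝ) : Measure ((daryTree d).edgeSet → Bool) :=
  ∑ η, ENNReal.ofReal (ν η) • Measure.dirac (extendEdges η.2)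

theorem isProbabilityMeasure_finalEdgeMeasure (hα : 0 < α) {S : Finset (List (Fin d))}
    {ν : PCFConfig (subtreeGraph S) → ℝ} (hν : IsPCFFinalLaw (subtreeGraph S) α ν) :
    IsProbabilityMeasure (finalEdgeMeasure ν) := by
  constructor
  simp only [finalEdgeMeasure, Measure.coe_finsetSum, Finset.sum_apply, Measure.smul_apply,
    measure_univ, smul_eq_mul, mul_one]
  rw [← ENNReal.ofReal_sum_of_nonneg fun η _ => hν.nonneg hα.le η, hν.sum_eq_one,
    ENNReal.ofReal_one]

theorem finalEdgeMeasure_real_cylinder (hα : 0 < α) {S : Finset (List (Fin d))}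
    {ν : PCFConfig (subtreeGraph S) → ℝ} (hν : IsPCFFinalLaw (subtreeGraph S) α ν)
    (F : Finset (daryTree d).edgeSet) (ω : (daryTree d).edgeSet → Bool) :
    (finalEdgeMeasure ν).real {σ | ∀ e ∈ F, σ e = ω e} =
      ∑ η, if ∀ e ∈ F, extendEdges η.2 e = ω e then ν η else 0 := by
  have h : finalEdgeMeasure ν {σ | ∀ e ∈ F, σ e = ω e} =
      ∑ η, ENNReal.ofReal (if ∀ e ∈ F, extendEdges η.2 e = ω e then ν η else 0) := by
    simp only [finalEdgeMeasure, Measure.coe_finsetSum, Finset.sum_apply, Measure.smul_apply,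
      smul_eq_mul, Measure.dirac_apply' _ (measurableSet_edgeCylinder F ω)]
    refine Finset.sum_congr rfl fun η _ => ?_
    by_cases h : ∀ e ∈ F, extendEdges η.2 e = ω e
    · rw [Set.indicator_of_mem (show extendEdges η.2 ∈ {σ | ∀ e ∈ F, σ e = ω e} from h),
        if_pos h]
      simp
    · rw [Set.indicator_of_notMem (show extendEdges η.2 ∉ {σ | ∀ e ∈ F, σ e = ω e} from h),
        if_neg h]
      simp
  have h0 : ∀ η, 0 ≤ if ∀ e ∈ F, extendEdges η.2 e = ω e then ν η else 0 := by
    intro η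
    split_ifs
    · exact hν.nonneg hα.le η
    · exact le_rfl
  rw [Measure.real, h, ← ENNReal.ofReal_sum_of_nonneg fun η _ => h0 η,
    ENNReal.toReal_ofReal (Finset.sum_nonneg fun η _ => h0 η)]

/-- The measure is a limit point of the finite-volume laws, by compactness of the space of
probability measures; the probabilities of cylinders are eventually constant. -/
theorem exists_isPCFMeasure (d : ℕ) (hα : 0 < α) :
    ∃ μ : Measure ((daryTree d).edgeSet → Bool), IsPCFMeasure (daryTree d) α μ := by
  choose ν hν using fun S : Finset (List (Fin d)) =>
    exists_isPCFFinalLaw (subtreeGraph S) hα.le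
  let P : Finset (List (Fin d)) → ProbabilityMeasure ((daryTree d).edgeSet → Bool) :=
    fun S => ⟨finalEdgeMeasure (ν S), isProbabilityMeasure_finalEdgeMeasure hα (hν S)⟩
  let U : Ultrafilter (Finset (List (Fin d))) := Ultrafilter.of atTop
  obtain ⟨μ, -, hμ⟩ := isCompact_univ.ultrafilter_le_nhds (U.map P) (by simp)
  have hμ' : Tendsto P U (𝓝 μ) := hμ
  refine ⟨μ, inferInstance, ν, hν, fun F ω => ?_⟩
  obtain ⟨n, hn⟩ := exists_treeBall_edges F
  have hB := isRootedSubtree_treeBall (d := d) n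
  have hconst : Tendsto (fun S : Finset (List (Fin d)) =>
      ∑ η, if ∀ e ∈ F, extendEdges η.2 e = ω e then ν S η else 0) atTop
      (𝓝 (∑ η, if ∀ e ∈ F, extendEdges η.2 e = ω e then ν (treeBall d n) η else 0)) := by
    refine tendsto_const_nhds.congr' ?_
    filter_upwards [eventually_ge_atTop (treeBall d n)] with S hS
    exact (hB.sum_cylinder hS (hν S) (hν _) F hn ω).symm
  have hlim : Tendsto (fun S => (P S : Measure ((daryTree d).edgeSet → Bool)).real
      {σ | ∀ e ∈ F, σ e = ω e}) U
      (𝓝 ((μ : Measure ((daryTree d).edgeSet → Bool)).real {σ | ∀ e ∈ F, σ e = ω e})) := by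
    have h := ProbabilityMeasure.tendsto_measure_of_null_frontier_of_tendsto' hμ'
      (E := {σ | ∀ e ∈ F, σ e = ω e})
      (by rw [(isClopen_edgeCylinder F ω).frontier_eq]; exact measure_empty)
    exact (ENNReal.tendsto_toReal (measure_ne_top _ _)).comp h
  have heq : (μ : Measure ((daryTree d).edgeSet → Bool)).real {σ | ∀ e ∈ F, σ e = ω e} =
      ∑ η, if ∀ e ∈ F, extendEdges η.2 e = ω e then ν (treeBall d n) η else 0 := by
    refine tendsto_nhds_unique hlim ((hconst.mono_left (Ultrafilter.of_le atTop)).congr fun S => ?_)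
    exact (finalEdgeMeasure_real_cylinder hα (hν S) F ω).symm
  rw [heq]
  exact hconst

/-- The probability that all the edges of a rooted subtree `A` are open. -/
theorem IsPCFMeasure.real_allOpen (hα : 0 < α) {μ : Measure ((daryTree d).edgeSet → Bool)}
    (hμ : IsPCFMeasure (daryTree d) α μ) {A : Finset (List (Fin d))} (hA : IsRootedSubtree A) :
    μ.real {σ | ∀ v ∈ A, ∀ hv : v ≠ [], σ (parentEdge v hv) = true} =
      allOpenProb α (A.card - 1) := by
  obtain ⟨ν, hν, hlim⟩ := hμ.exists_localLimit
  have := Fintype.ofFinite (subtreeGraph A).edgeSet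
  let emb : (subtreeGraph A).edgeSet ↪ (daryTree d).edgeSet :=
    (SimpleGraph.Embedding.induce (A : Set (List (Fin d)))).mapEdgeSet
  have hemb : ∀ e' : (subtreeGraph A).edgeSet,
      Sym2.map Subtype.val (e' : Sym2 (A : Set (List (Fin d)))) =
      (emb e' : Sym2 (List (Fin d))) := fun e' => rfl
  let F : Finset (daryTree d).edgeSet := Finset.univ.map emb
  have h1 := hlim F fun _ => true
  have h2 : ∑ η, (if ∀ e ∈ F, extendEdges η.2 e = true then ν A η else 0) =
      allOpenProb α (A.card - 1) := by
    have h3 := (hν A).sum_allOpen hA.connected hα hA.card_connectedComponent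
    rw [← hA.card_edgeSet, add_tsub_cancel_right, ← h3]
    refine Finset.sum_congr rfl fun η _ => ?_
    have : (∀ e ∈ F, extendEdges η.2 e = true) ↔ ∀ e, η.2 e = true := by
      simp only [F, Finset.mem_map, Finset.mem_univ, true_and, forall_exists_index,
        forall_apply_eq_imp_iff, extendEdges_apply _ (hemb _)]
    simp only [allOpenIndicator, this, mul_ite, mul_one, mul_zero]
  have h4 : {σ : (daryTree d).edgeSet → Bool |
      ∀ v ∈ A, ∀ hv : v ≠ [], σ (parentEdge v hv) = true} = {σ | ∀ e ∈ F, σ e = true} := by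
    ext σ
    simp only [F, Set.mem_ofPred_eq, Finset.mem_map, Finset.mem_univ, true_and,
      forall_exists_index, forall_apply_eq_imp_iff, hA.edge_bijective.2.forall]
    exact ⟨fun h v => h v.1.1 v.1.2 v.2, fun h v hv hv0 => h ⟨⟨v, hv⟩, hv0⟩⟩
  rw [h4, ← h2]
  refine tendsto_nhds_unique h1 (tendsto_const_nhds.congr' ?_)
  filter_upwards [eventually_ge_atTop A] with S hS
  refine (hA.sum_cylinder hS (hν S) (hν A) F (fun e he => ?_) _).symm
  obtain ⟨e', -, rfl⟩ := Finset.mem_map.1 he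
  exact ⟨e', hemb e'⟩

end Existence

/-! ### The cluster of the root -/

section RootCluster

variable {d : ℕ} {α : ℝ}

/-- All the edges on the way from the vertex to the root are open. -/
def IsOpenToRoot (σ : (daryTree d).edgeSet → Bool) : List (Fin d) → Prop
  | [] => True
  | i :: u => σ (parentEdge (i :: u) (List.cons_ne_nil i u)) = true ∧ IsOpenToRoot σ u

theorem mem_openCluster_nil_iff {σ : (daryTree d).edgeSet → Bool} {v : List (Fin d)} :
    v ∈ openCluster σ [] ↔ IsOpenToRoot σ v := by
  constructor
  · have hstep : ∀ a b : List (Fin d), (openGraph σ).Adj a b →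
        (IsOpenToRoot σ a ↔ IsOpenToRoot σ b) := by
      have key : ∀ a b : List (Fin d), (openGraph σ).Adj a b → b ≠ [] → b.tail = a →
          (IsOpenToRoot σ a ↔ IsOpenToRoot σ b) := by
        rintro a b ⟨h, hσ⟩ hb rfl
        cases b with
        | nil => exact absurd rfl hb
        | cons i u => exact ⟨fun hu => ⟨hσ, hu⟩, fun hu => hu.2⟩
      intro a b hab
      rcases daryTree_adj.1 hab.1 with ⟨h0, h1⟩ | ⟨h0, h1⟩
      · exact key a b hab h0 h1
      · exact (key b a hab.symm h0 h1).symm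
    have hwalk : ∀ a b : List (Fin d), (openGraph σ).Walk a b →
        (IsOpenToRoot σ a ↔ IsOpenToRoot σ b) := by
      intro a b p
      induction p with
      | nil => rfl
      | cons h _ ih => exact (hstep _ _ h).trans ih
    rintro ⟨p⟩
    exact (hwalk _ _ p).1 trivial
  · induction v with
    | nil => exact fun _ => SimpleGraph.Reachable.refl _
    | cons i u ih =>
      rintro ⟨h1, h2⟩
      refine (ih h2).trans (SimpleGraph.Adj.reachable ⟨?_, h1⟩)
      exact daryTree_adj.2 (Or.inl ⟨List.cons_ne_nil i u, rfl⟩)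

/-- The children of the vertices of `A` that do not belong to `A`. -/
noncomputable def childBoundary (A : Finset (List (Fin d))) : Finset (List (Fin d)) :=
  (Finset.univ ×ˢ A).image (fun p : Fin d × List (Fin d) => p.1 :: p.2) \ A

theorem cons_mem_childBoundary {A : Finset (List (Fin d))} {i : Fin d} {u : List (Fin d)} :
    i :: u ∈ childBoundary A ↔ u ∈ A ∧ i :: u ∉ A := by
  simp [childBoundary]

theorem nil_notMem_childBoundary (A : Finset (List (Fin d))) : [] ∉ childBoundary A := by
  simp [childBoundary]

theorem IsRootedSubtree.card_childBoundary {A : Finset (List (Fin d))} (hA : IsRootedSubtree A) :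
    (childBoundary A).card = d * A.card - (A.card - 1) := by
  have himage : ((Finset.univ ×ˢ A).image
      (fun p : Fin d × List (Fin d) => p.1 :: p.2)).card = d * A.card := by
    rw [Finset.card_image_of_injective, Finset.card_product, Finset.card_univ, Fintype.card_fin]
    rintro ⟨i, u⟩ ⟨j, v⟩ h
    simpa using h
  have hsub : A.erase [] ⊆ (Finset.univ ×ˢ A).image
      (fun p : Fin d × List (Fin d) => p.1 :: p.2) := by
    intro v hv
    rw [Finset.mem_erase] at hv
    cases v with
    | nil => exact absurd rfl hv.1
    | cons i u => simpa using hA.tail_mem _ hv.2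
  have heq : childBoundary A = (Finset.univ ×ˢ A).image
      (fun p : Fin d × List (Fin d) => p.1 :: p.2) \ A.erase [] := by
    ext v
    cases v with
    | nil => simp [childBoundary]
    | cons i u => simp [childBoundary]
  rw [heq, Finset.card_sdiff_of_subset hsub, himage, Finset.card_erase_of_mem hA.nil_mem]

/-- The event that the edges above the vertices of `A` are open and those above the vertices of
`B` are closed. -/
def openClosedEvent (A B : Finset (List (Fin d))) : Set ((daryTree d).edgeSet → Bool) :=
  {σ | (∀ v ∈ A, ∀ hv : v ≠ [], σ (parentEdge v hv) = true) ∧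
    ∀ v ∈ B, ∀ hv : v ≠ [], σ (parentEdge v hv) = false}

theorem measurableSet_openClosedEvent (A B : Finset (List (Fin d))) :
    MeasurableSet (openClosedEvent A B) := by
  have h : ∀ (b : Bool) (A : Finset (List (Fin d))), MeasurableSet
      {σ : (daryTree d).edgeSet → Bool | ∀ v ∈ A, ∀ hv : v ≠ [], σ (parentEdge v hv) = b} := by
    intro b A
    have : {σ : (daryTree d).edgeSet → Bool |
        ∀ v ∈ A, ∀ hv : v ≠ [], σ (parentEdge v hv) = b} =
        ⋂ v ∈ A, ⋂ hv : v ≠ [], {σ | σ (parentEdge v hv) = b} := by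
      ext σ; simp
    rw [this]
    exact A.measurableSet_biInter fun v _ => MeasurableSet.iInter fun hv =>
      measurableSet_eq_fun (measurable_pi_apply _) measurable_const
  exact (h true A).inter (h false B)

/-- The root cluster is `A` if the edges of `A` are open and its boundary edges are closed. -/
theorem IsRootedSubtree.openCluster_eq_iff {A : Finset (List (Fin d))} (hA : IsRootedSubtree A)
    (σ : (daryTree d).edgeSet → Bool) :
    openCluster σ [] = (A : Set (List (Fin d))) ↔ σ ∈ openClosedEvent A (childBoundary A) := by
  rw [Set.ext_iff]
  simp only [mem_openCluster_nil_iff, Finset.mem_coe]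
  constructor
  · intro h
    refine ⟨fun v hv hv0 => ?_, fun v hv hv0 => ?_⟩
    · cases v with
      | nil => exact absurd rfl hv0
      | cons i u => exact ((h _).2 hv).1
    · cases v with
      | nil => exact absurd rfl hv0
      | cons i u =>
        rw [cons_mem_childBoundary] at hv
        by_contra hne
        exact hv.2 ((h _).1 ⟨by simpa using hne, (h _).2 hv.1⟩)
  · rintro ⟨h1, h2⟩ v
    induction v with
    | nil => exact ⟨fun _ => hA.nil_mem, fun _ => trivial⟩
    | cons i u ih =>
      constructor
      · rintro ⟨ho, hu⟩
        by_contra hv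
        have := h2 _ (cons_mem_childBoundary.2 ⟨ih.1 hu, hv⟩) (List.cons_ne_nil i u)
        rw [this] at ho
        cases ho
      · exact fun hv => ⟨h1 _ hv _, ih.2 (hA.tail_mem _ hv)⟩

/-- The probability that in the final configuration on a tree with `n + m` edges, `n` of which
form a subtree and the others of which are adjacent to it, the former are open and the latter
closed. -/
noncomputable def openClosedProb (α : ℝ) : ℕ → ℕ → ℝ
  | n, 0 => allOpenProb α n
  | n, m + 1 => openClosedProb α n m - openClosedProb α (n + 1) m

theorem IsPCFMeasure.real_openClosedEvent (hα : 0 < α)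
    {μ : Measure ((daryTree d).edgeSet → Bool)} (hμ : IsPCFMeasure (daryTree d) α μ)
    (B : Finset (List (Fin d))) : ∀ {A : Finset (List (Fin d))}, IsRootedSubtree A →
      (∀ v ∈ B, v.tail ∈ A ∧ v ∉ A) →
      μ.real (openClosedEvent A B) = openClosedProb α (A.card - 1) B.card := by
  have := hμ.isProbabilityMeasure
  induction B using Finset.induction_on with
  | empty =>
    intro A hA _
    rw [Finset.card_empty, openClosedProb, ← hμ.real_allOpen hα hA]
    simp [openClosedEvent]
  | insert b B hb ih =>
    intro A hA hB
    obtain ⟨hbt, hbA⟩ := hB b (Finset.mem_insert_self b B)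
    have hb0 : b ≠ [] := fun h => hbA (h ▸ hA.nil_mem)
    have hA' : IsRootedSubtree (insert b A) := by
      refine ⟨Finset.mem_insert_of_mem hA.nil_mem, fun v hv => Finset.mem_insert_of_mem ?_⟩
      rcases Finset.mem_insert.1 hv with rfl | hv
      · exact hbt
      · exact hA.tail_mem v hv
    have hA1 : 0 < A.card := Finset.card_pos.2 ⟨_, hA.nil_mem⟩
    have h1 := ih hA fun v hv => hB v (Finset.mem_insert_of_mem hv)
    have h2 := ih hA' fun v hv => by
      obtain ⟨hv1, hv2⟩ := hB v (Finset.mem_insert_of_mem hv)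
      refine ⟨Finset.mem_insert_of_mem hv1, fun h => ?_⟩
      rcases Finset.mem_insert.1 h with rfl | h
      · exact hb hv
      · exact hv2 h
    rw [Finset.card_insert_of_notMem hbA, show A.card + 1 - 1 = A.card - 1 + 1 by omega] at h2
    have hdiff : openClosedEvent A (insert b B) =
        openClosedEvent A B \ openClosedEvent (insert b A) B := by
      ext σ
      simp only [openClosedEvent, Set.mem_ofPred_eq, Set.mem_sdiff, Finset.forall_mem_insert]
      cases hσ : σ (parentEdge b hb0) <;> simp_all
    have hsub : openClosedEvent (insert b A) B ⊆ openClosedEvent A B :=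
      fun σ hσ => ⟨fun v hv => hσ.1 v (Finset.mem_insert_of_mem hv), hσ.2⟩
    rw [hdiff, measureReal_sdiff hsub (measurableSet_openClosedEvent _ _), h1, h2,
      Finset.card_insert_of_notMem hb, openClosedProb]

theorem IsRootedSubtree.length_lt_card {A : Finset (List (Fin d))} (hA : IsRootedSubtree A)
    {v : List (Fin d)} (hv : v ∈ A) : v.length < A.card := by
  have hdrop : ∀ j, v.drop j ∈ A := by
    intro j
    induction j with
    | zero => exact hv
    | succ j ih => simpa using hA.tail_mem _ ih
  have : (Finset.range (v.length + 1)).card ≤ A.card := by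
    refine Finset.card_le_card_of_injOn (fun j => v.drop j) (fun j _ => hdrop j) ?_
    intro i hi j hj hij
    have := congrArg List.length hij
    simp at hi hj this
    omega
  rw [Finset.card_range] at this
  omega

/-- The subtrees with `k` vertices that contain the root. -/
noncomputable def rootedSubtrees (d k : ℕ) : Finset (Finset (List (Fin d))) :=
  (treeBall d k).powerset.filter fun A => IsRootedSubtree A ∧ A.card = k

theorem mem_rootedSubtrees {k : ℕ} {A : Finset (List (Fin d))} :
    A ∈ rootedSubtrees d k ↔ IsRootedSubtree A ∧ A.card = k := by
  simp only [rootedSubtrees, Finset.mem_filter, Finset.mem_powerset, and_iff_right_iff_imp]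
  rintro ⟨hA, rfl⟩ v hv
  exact mem_treeBall.2 (hA.length_lt_card hv).le

theorem rootedSubtrees_zero (d : ℕ) : rootedSubtrees d 0 = ∅ := by
  refine Finset.eq_empty_of_forall_notMem fun A hA => ?_
  obtain ⟨h1, h2⟩ := mem_rootedSubtrees.1 hA
  rw [Finset.card_eq_zero.1 h2] at h1
  exact absurd h1.nil_mem (Finset.notMem_empty _)

theorem rootClusterSize_eq (d k : ℕ) :
    rootClusterSize d k = ⋃ A ∈ rootedSubtrees d k, openClosedEvent A (childBoundary A) := by
  ext σ
  simp only [rootClusterSize, Set.mem_ofPred_eq, Set.mem_iUnion, exists_prop, mem_rootedSubtrees]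
  constructor
  · intro h
    have hfin : (openCluster σ []).Finite := Set.finite_of_encard_eq_coe h
    have hA : IsRootedSubtree hfin.toFinset := by
      refine ⟨hfin.mem_toFinset.2 (SimpleGraph.Reachable.refl _), fun v hv => ?_⟩
      rw [Set.Finite.mem_toFinset, mem_openCluster_nil_iff] at *
      cases v with
      | nil => trivial
      | cons i u => exact hv.2
    refine ⟨hfin.toFinset, ⟨hA, ?_⟩, (hA.openCluster_eq_iff σ).1 (by simp)⟩
    rw [hfin.encard_eq_coe_toFinset_card] at h
    exact_mod_cast h
  · rintro ⟨A, ⟨hA, rfl⟩, hσ⟩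
    rw [(hA.openCluster_eq_iff σ).2 hσ, Set.encard_coe_eq_coe_finsetCard]

theorem IsPCFMeasure.real_rootClusterSize (hα : 0 < α)
    {μ : Measure ((daryTree d).edgeSet → Bool)} (hμ : IsPCFMeasure (daryTree d) α μ) (k : ℕ) :
    μ.real (rootClusterSize d k) =
      (rootedSubtrees d k).card * openClosedProb α (k - 1) (d * k - (k - 1)) := by
  have := hμ.isProbabilityMeasure
  rw [rootClusterSize_eq, measureReal_biUnion_finset]
  · rw [← nsmul_eq_mul, ← Finset.sum_const]
    refine Finset.sum_congr rfl fun A hA => ?_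
    obtain ⟨hA', rfl⟩ := mem_rootedSubtrees.1 hA
    rw [hμ.real_openClosedEvent hα _ hA', hA'.card_childBoundary]
    intro v hv
    cases v with
    | nil => exact absurd hv (nil_notMem_childBoundary A)
    | cons i u => exact cons_mem_childBoundary.1 hv
  · intro A hA B hB hAB
    refine Set.disjoint_left.2 fun σ h1 h2 => hAB ?_
    rw [← IsRootedSubtree.openCluster_eq_iff (mem_rootedSubtrees.1 hA).1] at h1
    rw [← IsRootedSubtree.openCluster_eq_iff (mem_rootedSubtrees.1 hB).1] at h2
    exact_mod_cast h1.symm.trans h2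
  · exact fun A _ => measurableSet_openClosedEvent _ _

end RootCluster

/-! ### The number of subtrees containing the root -/

section Counting

variable {d : ℕ}

/-- The sets of `n` vertices that are empty or rooted subtrees. -/
noncomputable def optionalSubtrees (d n : ℕ) : Finset (Finset (List (Fin d))) :=
  if n = 0 then {∅} else rootedSubtrees d n

theorem mem_optionalSubtrees {n : ℕ} {A : Finset (List (Fin d))} :
    A ∈ optionalSubtrees d n ↔ (∀ v ∈ A, v.tail ∈ A) ∧ A.card = n := by
  rw [optionalSubtrees]
  split_ifs with h
  · subst h
    simp only [Finset.mem_singleton, Finset.card_eq_zero, iff_and_self]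
    rintro rfl
    simp
  · rw [mem_rootedSubtrees]
    refine and_congr_left fun hc => ⟨fun hA => hA.tail_mem, fun hA => ⟨?_, hA⟩⟩
    obtain ⟨v, hv⟩ := Finset.card_pos.1 (by omega : 0 < A.card)
    induction v with
    | nil => exact hv
    | cons i u ih => exact ih (hA _ hv)

/-- The part of a set of vertices in the subtree of the `i`-th child of the root. -/
noncomputable def rootBranch (A : Finset (List (Fin d))) (i : Fin d) : Finset (List (Fin d)) :=
  A.preimage (fun u => u ++ [i]) (List.append_left_injective [i]).injOn

theorem mem_rootBranch {A : Finset (List (Fin d))} {i : Fin d} {u : List (Fin d)} :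
    u ∈ rootBranch A i ↔ u ++ [i] ∈ A := Finset.mem_preimage

/-- The set consisting of the root and given sets in the subtrees of its children. -/
noncomputable def joinBranches (f : Fin d → Finset (List (Fin d))) : Finset (List (Fin d)) :=
  insert [] (Finset.univ.biUnion fun i => (f i).image fun u => u ++ [i])

theorem nil_mem_joinBranches (f : Fin d → Finset (List (Fin d))) : [] ∈ joinBranches f :=
  Finset.mem_insert_self _ _

theorem append_mem_joinBranches {f : Fin d → Finset (List (Fin d))} {i : Fin d}
    {u : List (Fin d)} : u ++ [i] ∈ joinBranches f ↔ u ∈ f i := by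
  simp only [joinBranches, Finset.mem_insert, List.append_eq_nil_iff, List.cons_ne_self,
    and_false, false_or, Finset.mem_biUnion, Finset.mem_univ, true_and, Finset.mem_image]
  constructor
  · rintro ⟨j, v, hv, h⟩
    obtain ⟨rfl, h2⟩ := List.append_inj' h rfl
    obtain rfl : j = i := by simpa using h2
    exact hv
  · exact fun h => ⟨i, u, h, rfl⟩

theorem card_joinBranches (f : Fin d → Finset (List (Fin d))) :
    (joinBranches f).card = ∑ i, (f i).card + 1 := by
  rw [joinBranches, Finset.card_insert_of_notMem (by simp), Finset.card_biUnion]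
  · congr 1
    exact Finset.sum_congr rfl fun i _ =>
      Finset.card_image_of_injective _ (List.append_left_injective [i])
  · intro i _ j _ hij
    refine Finset.disjoint_left.2 fun v h1 h2 => hij ?_
    obtain ⟨u, -, rfl⟩ := Finset.mem_image.1 h1
    obtain ⟨w, -, h⟩ := Finset.mem_image.1 h2
    have := (List.append_inj' h rfl).2
    simpa using this.symm

theorem joinBranches_rootBranch {A : Finset (List (Fin d))} (hA : [] ∈ A) :
    joinBranches (rootBranch A) = A := by
  ext v
  induction v using List.reverseRecOn with
  | nil => simp [hA, nil_mem_joinBranches]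
  | append_singleton u i => rw [append_mem_joinBranches, mem_rootBranch]

theorem rootBranch_joinBranches (f : Fin d → Finset (List (Fin d))) :
    rootBranch (joinBranches f) = f := by
  funext i
  ext u
  rw [mem_rootBranch, append_mem_joinBranches]

theorem isRootedSubtree_joinBranches {f : Fin d → Finset (List (Fin d))} :
    IsRootedSubtree (joinBranches f) ↔ ∀ i, ∀ v ∈ f i, v.tail ∈ f i := by
  constructor
  · intro h i v hv
    cases v with
    | nil => exact hv
    | cons j u =>
      have := h.tail_mem _ (append_mem_joinBranches.2 hv)
      rw [List.cons_append, List.tail_cons, append_mem_joinBranches] at this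
      exact this
  · refine fun h => ⟨nil_mem_joinBranches f, fun v hv => ?_⟩
    induction v using List.reverseRecOn with
    | nil => exact hv
    | append_singleton u i =>
      cases u with
      | nil => exact nil_mem_joinBranches f
      | cons j u =>
        rw [append_mem_joinBranches] at hv
        rw [List.cons_append, List.tail_cons, append_mem_joinBranches]
        exact h i _ hv

theorem card_rootedSubtrees_succ (d k : ℕ) : (rootedSubtrees d (k + 1)).card =
    ∑ l ∈ (Finset.univ : Finset (Fin d)).finsuppAntidiag k,
      ∏ i, (optionalSubtrees d (l i)).card := by
  have hsum : ∀ A ∈ rootedSubtrees d (k + 1), ∑ i, (rootBranch A i).card = k := by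
    intro A hA
    rw [mem_rootedSubtrees] at hA
    have h := card_joinBranches (rootBranch A)
    rw [joinBranches_rootBranch hA.1.nil_mem, hA.2] at h
    omega
  rw [Finset.card_eq_sum_card_fiberwise
    (f := fun A => Finsupp.equivFunOnFinite.symm fun i => (rootBranch A i).card)
    (t := (Finset.univ : Finset (Fin d)).finsuppAntidiag k)]
  · refine Finset.sum_congr rfl fun l hl => ?_
    rw [← Fintype.card_piFinset]
    refine Finset.card_nbij' rootBranch joinBranches ?_ ?_ ?_ ?_
    · intro A hA
      simp only [Finset.coe_filter, Set.mem_ofPred_eq, mem_rootedSubtrees] at hA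
      obtain ⟨⟨hA, -⟩, rfl⟩ := hA
      rw [← joinBranches_rootBranch hA.nil_mem, isRootedSubtree_joinBranches] at hA
      simp only [Finset.mem_coe, Fintype.mem_piFinset, mem_optionalSubtrees]
      exact fun i => ⟨hA i, rfl⟩
    · intro f hf
      simp only [Finset.mem_coe, Fintype.mem_piFinset, mem_optionalSubtrees] at hf
      simp only [Finset.mem_finsuppAntidiag] at hl
      simp only [Finset.coe_filter, Set.mem_ofPred_eq, mem_rootedSubtrees,
        isRootedSubtree_joinBranches, rootBranch_joinBranches, card_joinBranches, hf]
      refine ⟨⟨fun i => (hf i).1, by rw [← hl.1]⟩, ?_⟩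
      ext i
      rfl
    · intro A hA
      simp only [Finset.coe_filter, Set.mem_ofPred_eq, mem_rootedSubtrees] at hA
      exact joinBranches_rootBranch hA.1.1.nil_mem
    · intro f _
      exact rootBranch_joinBranches f
  · intro A hA
    simpa [Finset.mem_finsuppAntidiag] using hsum A hA

/-- The generating function of the numbers of empty or rooted subtrees. -/
noncomputable def subtreeSeries (d : ℕ) : PowerSeries ℝ :=
  PowerSeries.mk fun n => ((optionalSubtrees d n).card : ℝ)

theorem subtreeSeries_eq (d : ℕ) :
    subtreeSeries d = 1 + PowerSeries.X * subtreeSeries d ^ d := by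
  ext n
  cases n with
  | zero => simp [subtreeSeries, optionalSubtrees]
  | succ k =>
    have h : subtreeSeries d ^ d = ∏ _i : Fin d, subtreeSeries d := by simp
    rw [map_add, PowerSeries.coeff_succ_X_mul, h, PowerSeries.coeff_prod]
    simp [subtreeSeries, optionalSubtrees, PowerSeries.coeff_one, card_rootedSubtrees_succ]

/-- The coefficients of the powers of the generating function; those of the `r`-th power count
forests with `r` components. -/
theorem coeff_subtreeSeries_pow (hd : 1 ≤ d) (k r : ℕ) :
    ((d : ℝ) * k + r) * PowerSeries.coeff k (subtreeSeries d ^ r) =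
      r * ((d * k + r).choose k : ℝ) := by
  have hrec : ∀ r, subtreeSeries d ^ (r + 1) =
      subtreeSeries d ^ r + PowerSeries.X * subtreeSeries d ^ (r + d) := by
    intro r
    rw [pow_succ]
    nth_rewrite 2 [subtreeSeries_eq d]
    ring
  induction k generalizing r with
  | zero =>
    have h0 : PowerSeries.constantCoeff (subtreeSeries d) = 1 := by
      rw [subtreeSeries_eq]; simp
    simp [h0]
  | succ k ihk =>
    induction r with
    | zero => simp [PowerSeries.coeff_one]
    | succ r ihr =>
      rw [hrec, map_add, PowerSeries.coeff_succ_X_mul]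
      have h1 := ihk (r + d)
      have hM : d * (k + 1) + r = d * k + (r + d) := by ring
      have hM1 : d * (k + 1) + (r + 1) = d * k + (r + d) + 1 := by ring
      rw [hM] at ihr
      rw [hM1, Nat.choose_succ_succ]
      have hk : k ≤ d * k + (r + d) := by nlinarith
      have h2 := Nat.choose_succ_right_eq (d * k + (r + d)) k
      have h3 : ((d * k + (r + d)).choose (k + 1) : ℝ) * (k + 1) =
          (d * k + (r + d)).choose k * ((d : ℝ) * k + (r + d) - k) := by
        have := congrArg (Nat.cast : ℕ → ℝ) h2
        push_cast [Nat.cast_sub hk] at this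
        exact this
      have hpos : (0 : ℝ) < (d : ℝ) * k + (r + d) := by
        have : (1 : ℝ) ≤ d := by exact_mod_cast hd
        positivity
      push_cast at ihr h1 ⊢
      apply mul_left_cancel₀ hpos.ne'
      generalize PowerSeries.coeff (k + 1) (subtreeSeries d ^ r) = a at *
      generalize PowerSeries.coeff k (subtreeSeries d ^ (r + d)) = b at *
      generalize ((d * k + (r + d)).choose (k + 1) : ℝ) = x at *
      generalize ((d * k + (r + d)).choose k : ℝ) = y at *
      linear_combination ((d : ℝ) * (k + 1) + (r + 1)) * ihr +
        ((d : ℝ) * (k + 1) + (r + 1)) * h1 - d * h3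

/-- The Fuss-Catalan formula for the number of rooted subtrees. -/
theorem card_rootedSubtrees (hd : 1 ≤ d) {k : ℕ} (hk : k ≠ 0) :
    (((d : ℝ) - 1) * k + 1) * (rootedSubtrees d k).card = (d * k).choose k := by
  have h := coeff_subtreeSeries_pow hd k 1
  have h1 : PowerSeries.coeff k (subtreeSeries d ^ 1) = ((rootedSubtrees d k).card : ℝ) := by
    simp [subtreeSeries, optionalSubtrees, hk]
  rw [h1] at h
  have hkd : k ≤ d * k := Nat.le_mul_of_pos_left k hd
  have h2 := congrArg (Nat.cast : ℕ → ℝ) (Nat.choose_mul_succ_eq (d * k) k)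
  rw [show d * k + 1 - k = d * k - k + 1 by omega] at h2
  push_cast [Nat.cast_sub hkd] at h2 h
  have hpos : (0 : ℝ) < (d : ℝ) * k + 1 := by positivity
  apply mul_left_cancel₀ hpos.ne'
  linear_combination (((d : ℝ) - 1) * k + 1) * h - h2

end Counting

/-! ### Integral formula for the cluster probabilities -/

section IntegralFormula

theorem intervalIntegrable_rpow_neg_mul {s : ℝ} (hs : s < 1) {f : ℝ → ℝ} (hf : Continuous f) :
    IntervalIntegrable (fun y : ℝ => y ^ (-s) * f y) volume 0 1 :=
  (intervalIntegral.intervalIntegrable_rpow' (by linarith)).mul_continuousOn hf.continuousOn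

theorem integral_rpow_neg_mul_one_sub_pow_succ {s : ℝ} (hs : s < 1) (n : ℕ) :
    ((n : ℝ) + 2 - s) * ∫ y in (0 : ℝ)..1, y ^ (-s) * (1 - y) ^ (n + 1) =
      ((n : ℝ) + 1) * ∫ y in (0 : ℝ)..1, y ^ (-s) * (1 - y) ^ n := by
  have hint : ∀ m : ℕ, IntervalIntegrable (fun y : ℝ => y ^ (-s) * (1 - y) ^ m) volume 0 1 :=
    fun m => intervalIntegrable_rpow_neg_mul hs (by fun_prop)
  -- integrate the derivative of `y ^ (1 - s) * (1 - y) ^ (n + 1)`, which vanishes at both ends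
  have h := intervalIntegral.integral_eq_sub_of_hasDerivAt_of_le (a := 0) (b := 1)
    (f := fun y : ℝ => y ^ (1 - s) * (1 - y) ^ (n + 1))
    (f' := fun y : ℝ => ((n : ℝ) + 2 - s) * (y ^ (-s) * (1 - y) ^ (n + 1)) -
      ((n : ℝ) + 1) * (y ^ (-s) * (1 - y) ^ n)) zero_le_one ?_ ?_
    (((hint (n + 1)).const_mul _).sub ((hint n).const_mul _))
  · rw [intervalIntegral.integral_sub ((hint (n + 1)).const_mul _) ((hint n).const_mul _),
      intervalIntegral.integral_const_mul, intervalIntegral.integral_const_mul,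
      Real.zero_rpow (by linarith)] at h
    simp only [sub_self, ne_eq, Nat.add_eq_zero_iff, one_ne_zero, and_false, not_false_eq_true,
      zero_pow, mul_zero, zero_mul] at h
    linarith
  · exact ((Real.continuous_rpow_const (by linarith)).mul (by fun_prop)).continuousOn
  · intro y hy
    have h1 := Real.hasDerivAt_rpow_const (x := y) (p := 1 - s) (Or.inl hy.1.ne')
    have h2 : HasDerivAt (fun y : ℝ => (1 - y) ^ (n + 1))
        (((n + 1 : ℕ) : ℝ) * (1 - y) ^ n * (-1)) y := by
      simpa using ((hasDerivAt_id' y).const_sub 1).fun_pow (n + 1)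
    refine (h1.fun_mul h2).congr_deriv ?_
    have h3 : y ^ (1 - s) = y * y ^ (-s) := by
      rw [sub_eq_add_neg, Real.rpow_add hy.1, Real.rpow_one]
    rw [h3, show 1 - s - 1 = -s by ring]
    push_cast
    ring

theorem allOpenProb_eq_integral {α : ℝ} (hα : 0 < α) (n : ℕ) :
    allOpenProb α n = ∫ y in (0 : ℝ)..1,
      (α / (1 + α)) * y ^ (-(1 / (1 + α))) * ((1 - y) / (1 + α)) ^ n := by
  have hs : 1 / (1 + α) < 1 := by
    rw [div_lt_one (by linarith)]
    linarith
  have hform : ∀ n : ℕ, (∫ y in (0 : ℝ)..1,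
      (α / (1 + α)) * y ^ (-(1 / (1 + α))) * ((1 - y) / (1 + α)) ^ n) =
      (α / (1 + α)) / (1 + α) ^ n * ∫ y in (0 : ℝ)..1, y ^ (-(1 / (1 + α))) * (1 - y) ^ n := by
    intro n
    rw [← intervalIntegral.integral_const_mul]
    congr 1
    funext y
    rw [div_pow]
    ring
  have hc : (1 + α) ≠ 0 := by linarith
  induction n with
  | zero =>
    rw [hform, allOpenProb_zero]
    simp only [pow_zero, mul_one]
    rw [integral_rpow (Or.inl (by linarith)), Real.one_rpow, Real.zero_rpow (by linarith)]
    have : -(1 / (1 + α)) + 1 ≠ 0 := by linarith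
    field_simp
    ring_nf
    field_simp
  | succ n ih =>
    have h1 := allOpenProb_succ hα.le n
    have h2 := integral_rpow_neg_mul_one_sub_pow_succ hs n
    rw [ih, hform] at h1
    rw [hform]
    have hpos : (n : ℝ) + 1 + α * ((n : ℝ) + 2) ≠ 0 := by positivity
    apply mul_left_cancel₀ hpos
    rw [h1]
    have h3 : ((n : ℝ) + 1 + α * ((n : ℝ) + 2)) = (1 + α) * ((n : ℝ) + 2 - 1 / (1 + α)) := by
      field_simp
      ring
    rw [h3, pow_succ]
    have h4 : (1 + α) * (α / (1 + α) / ((1 + α) ^ n * (1 + α))) =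
        α / (1 + α) / (1 + α) ^ n := by field_simp
    linear_combination (-(α / (1 + α) / (1 + α) ^ n)) * h2 - ((n : ℝ) + 2 - 1 / (1 + α)) *
      (∫ y in (0 : ℝ)..1, y ^ (-(1 / (1 + α))) * (1 - y) ^ (n + 1)) * h4

theorem openClosedProb_eq_integral {α : ℝ} (hα : 0 < α) (n m : ℕ) :
    openClosedProb α n m = ∫ y in (0 : ℝ)..1, (α / (1 + α)) * y ^ (-(1 / (1 + α))) *
      (((1 - y) / (1 + α)) ^ n * (1 - (1 - y) / (1 + α)) ^ m) := by
  have hs : 1 / (1 + α) < 1 := by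
    rw [div_lt_one (by linarith)]
    linarith
  have hint : ∀ n m : ℕ, IntervalIntegrable (fun y : ℝ => (α / (1 + α)) *
      y ^ (-(1 / (1 + α))) * (((1 - y) / (1 + α)) ^ n * (1 - (1 - y) / (1 + α)) ^ m))
      volume 0 1 := by
    intro n m
    have := (intervalIntegrable_rpow_neg_mul (f := fun y : ℝ => ((1 - y) / (1 + α)) ^ n *
      (1 - (1 - y) / (1 + α)) ^ m) hs (by fun_prop)).const_mul (α / (1 + α))
    simpa only [mul_assoc] using this
  induction m generalizing n with
  | zero => simp [openClosedProb, allOpenProb_eq_integral hα]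
  | succ m ih =>
    rw [openClosedProb, ih, ih, ← intervalIntegral.integral_sub (hint _ _) (hint _ _)]
    congr 1
    funext y
    ring

end IntegralFormula

/-! ### Stirling's formula for the number of subtrees -/

section Binomial

/-- The maximum of `q * (1 - q) ^ (d - 1)` over `q` in `[0, 1]`, attained at `q = 1 / d`. -/
noncomputable def criticalValue (d : ℕ) : ℝ := 1 / d * (1 - 1 / d) ^ (d - 1)

theorem criticalValue_pos {d : ℕ} (hd : 1 ≤ d) : 0 < criticalValue d := by
  rcases hd.eq_or_lt with rfl | hd
  · simp [criticalValue]
  · have h1 : (1 : ℝ) < d := by exact_mod_cast hd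
    have : 1 / (d : ℝ) < 1 := by rw [div_lt_one] <;> linarith
    exact mul_pos (by positivity) (pow_pos (by linarith) _)

theorem choose_mul_criticalValue_pow_le_one {d : ℕ} (hd : 1 ≤ d) (k : ℕ) :
    ((d * k).choose k : ℝ) * criticalValue d ^ k ≤ 1 := by
  have h1 : (1 : ℝ) ≤ d := by exact_mod_cast hd
  have h0 : 1 / (d : ℝ) ≤ 1 := by rw [div_le_one] <;> linarith
  have hk : k ≤ d * k := Nat.le_mul_of_pos_left k hd
  -- a term of the binomial expansion of `(1 / d + (1 - 1 / d)) ^ (d * k)`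
  have h := add_pow (1 / (d : ℝ)) (1 - 1 / d) (d * k)
  rw [add_sub_cancel, one_pow] at h
  rw [h]
  have := Finset.single_le_sum (f := fun m => (1 / (d : ℝ)) ^ m * (1 - 1 / d) ^ (d * k - m) *
    ((d * k).choose m : ℝ)) (fun m _ => mul_nonneg (mul_nonneg (by positivity)
    (pow_nonneg (by linarith) _)) (by positivity)) (Finset.mem_range.2 (Nat.lt_succ_of_le hk))
  refine le_trans (le_of_eq ?_) this
  have he : d * k - k = (d - 1) * k := by rw [Nat.sub_mul, one_mul]
  simp only [criticalValue, he, mul_pow, ← pow_mul]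
  ring

theorem card_rootedSubtrees_mul_criticalValue_pow_le_one {d : ℕ} (hd : 1 ≤ d) (k : ℕ) :
    ((rootedSubtrees d k).card : ℝ) * criticalValue d ^ k ≤ 1 := by
  rcases eq_or_ne k 0 with rfl | hk
  · simp [rootedSubtrees_zero]
  · refine le_trans ?_ (choose_mul_criticalValue_pow_le_one hd k)
    have h1 : (1 : ℝ) ≤ d := by exact_mod_cast hd
    have : (1 : ℝ) ≤ ((d : ℝ) - 1) * k + 1 := by
      have : 0 ≤ ((d : ℝ) - 1) * k := mul_nonneg (by linarith) (by positivity)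
      linarith
    rw [← card_rootedSubtrees hd hk]
    refine mul_le_mul_of_nonneg_right ?_ (pow_nonneg (criticalValue_pos hd).le k)
    exact le_mul_of_one_le_left (by positivity) this

theorem factorial_eq_stirlingSeq_mul {n : ℕ} (hn : n ≠ 0) : (n.factorial : ℝ) =
    Stirling.stirlingSeq n * (√(2 * n) * (n / Real.exp 1) ^ n) := by
  have : (0 : ℝ) < n := by positivity
  rw [Stirling.stirlingSeq, div_mul_cancel₀]
  positivity

theorem tendsto_sqrt_mul_choose {d : ℕ} (hd : 2 ≤ d) : ∃ c : ℝ, 0 < c ∧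
    Tendsto (fun k : ℕ => √k * (((d * k).choose k : ℝ) * criticalValue d ^ k)) atTop (𝓝 c) := by
  have h2 : (2 : ℝ) ≤ d := by exact_mod_cast hd
  have hd1 : ((d - 1 : ℕ) : ℝ) = (d : ℝ) - 1 := by
    push_cast [Nat.cast_sub (by omega : 1 ≤ d)]; rfl
  have hS := Stirling.tendsto_stirlingSeq_sqrt_pi
  have hmul : ∀ a : ℕ, 0 < a → Tendsto (fun k : ℕ => Stirling.stirlingSeq (a * k)) atTop
      (𝓝 √Real.pi) := fun a ha =>
    hS.comp (tendsto_id.const_mul_atTop' ha)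
  have hlim := ((hmul d (by omega)).div (hS.mul (hmul (d - 1) (by omega)))
    (by positivity)).mul_const (√(2 * d) / (√2 * √(2 * (d - 1))))
  refine ⟨_, ?_, hlim.congr' ?_⟩
  · have : 0 < (d : ℝ) - 1 := by linarith
    positivity
  · filter_upwards [eventually_ne_atTop 0] with k hk
    have hkpos : (0 : ℝ) < k := by positivity
    have hkd : k ≤ d * k := Nat.le_mul_of_pos_left k (by omega)
    have he : d * k - k = (d - 1) * k := by rw [Nat.sub_mul, one_mul]
    have hdpos : (0 : ℝ) < d := by linarith
    have hd1pos : (0 : ℝ) < (d : ℝ) - 1 := by linarith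
    rw [Nat.cast_choose ℝ hkd, he, factorial_eq_stirlingSeq_mul hk,
      factorial_eq_stirlingSeq_mul (n := d * k) (by positivity),
      factorial_eq_stirlingSeq_mul (n := (d - 1) * k) (Nat.mul_ne_zero (by omega) hk)]
    have hs1 : 0 < Stirling.stirlingSeq k := by
      obtain ⟨j, rfl⟩ := Nat.exists_eq_succ_of_ne_zero hk
      exact Stirling.stirlingSeq'_pos j
    have hs2 : 0 < Stirling.stirlingSeq ((d - 1) * k) := by
      obtain ⟨j, hj⟩ := Nat.exists_eq_succ_of_ne_zero
        (Nat.mul_ne_zero (by omega : d - 1 ≠ 0) hk)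
      rw [hj]
      exact Stirling.stirlingSeq'_pos j
    have hE := Real.exp_pos 1
    push_cast
    rw [hd1]
    -- the powers cancel
    have hpow : ((d : ℝ) * k / Real.exp 1) ^ (d * k) * criticalValue d ^ k =
        (k / Real.exp 1) ^ k * (((d : ℝ) - 1) * k / Real.exp 1) ^ ((d - 1) * k) := by
      have h3 : d * k = k + (d - 1) * k := by
        rw [← he]; omega
      rw [h3, pow_add, criticalValue, mul_pow, ← pow_mul]
      have h4 : (d : ℝ) * k / Real.exp 1 * (1 / d) = k / Real.exp 1 := by field_simp
      have h5 : (d : ℝ) * k / Real.exp 1 * (1 - 1 / d) = ((d : ℝ) - 1) * k / Real.exp 1 := by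
        field_simp
      rw [← h4, ← h5, mul_pow, mul_pow _ (1 - 1 / (d : ℝ))]
      ring
    have hsq1 : √(2 * ((d : ℝ) * k)) = √(2 * d) * √k := by
      rw [← mul_assoc, Real.sqrt_mul (by positivity)]
    have hsq2 : √(2 * (((d : ℝ) - 1) * k)) = √(2 * (d - 1)) * √k := by
      rw [← mul_assoc, Real.sqrt_mul (by positivity)]
    have hsq3 : √(2 * (k : ℝ)) = √2 * √k := Real.sqrt_mul (by positivity) _
    rw [hsq1, hsq2, hsq3]
    simp only [Pi.div_apply]
    have hsk : 0 < √(k : ℝ) := by positivity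
    have hsd : 0 < √(2 * ((d : ℝ) - 1)) := by positivity
    have hs0 : 0 < √(2 : ℝ) := by positivity
    have hp1 : 0 < (k / Real.exp 1) ^ k := by positivity
    have hp2 : 0 < (((d : ℝ) - 1) * k / Real.exp 1) ^ ((d - 1) * k) := by positivity
    generalize ((d : ℝ) * k / Real.exp 1) ^ (d * k) = p₀ at *
    generalize (k / Real.exp 1) ^ k = p₁ at *
    generalize (((d : ℝ) - 1) * k / Real.exp 1) ^ ((d - 1) * k) = p₂ at *
    generalize criticalValue d ^ k = p₃ at *
    generalize Stirling.stirlingSeq ((d - 1) * k) = s₂ at *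
    generalize Stirling.stirlingSeq k = s₁ at *
    generalize Stirling.stirlingSeq (d * k) = s₀ at *
    generalize √(2 * ((d : ℝ) - 1)) = r₂ at *
    generalize √(2 * (d : ℝ)) = r₀ at *
    generalize √(k : ℝ) = r at *
    generalize √(2 : ℝ) = r₁ at *
    field_simp
    linear_combination (-(r₀ * s₀)) * hpow

end Binomial

/-! ### Laplace's method -/

section Laplace

theorem integrable_abs_rpow_mul_exp_neg_mul_sq {a b : ℝ} (ha : 0 < a) (hb : b < 1) :
    Integrable fun v : ℝ => |v| ^ (-b) * Real.exp (-a * v ^ 2) := by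
  have hIoi : IntegrableOn (fun v : ℝ => |v| ^ (-b) * Real.exp (-a * v ^ 2)) (Set.Ioi 0) := by
    refine (integrableOn_rpow_mul_exp_neg_mul_sq ha (s := -b) (by linarith)).congr_fun
      (fun v hv => ?_) measurableSet_Ioi
    simp only [abs_of_pos (Set.mem_Ioi.1 hv)]
  have hIic : IntegrableOn (fun v : ℝ => |v| ^ (-b) * Real.exp (-a * v ^ 2)) (Set.Iic 0) := by
    rw [← Measure.map_neg_eq_self (volume : Measure ℝ)]
    have hm : MeasurableEmbedding (Neg.neg : ℝ → ℝ) := (Homeomorph.neg ℝ).measurableEmbedding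
    rw [hm.integrableOn_map_iff]
    have h := (integrableOn_Ici_iff_integrableOn_Ioi enorm_ne_top).2 hIoi
    simpa [Function.comp_def] using h
  rw [← integrableOn_univ, ← Set.Iic_union_Ioi (a := (0 : ℝ))]
  exact hIic.union hIoi

/-- Laplace's method at a point where the weight `g` may have a power singularity: if
`ε ^ b * g (ε * v)` tends to `ℓ v` for `ε = 1 / √K`, and if `H ^ K` looks like a Gaussian at the scale
`1 / √K`, then the integral of `g * H ^ K` decays like `K ^ (-(1 - b) / 2)`. -/
theorem tendsto_laplace {g H ℓ : ℝ → ℝ} {a b κ δ M : ℝ} (ha : 0 < a) (hb : b < 1)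
    (hδ : 0 < δ) (hg : Integrable g) (hH : Measurable H)
    (hH0 : ∀ z, g z ≠ 0 → 0 ≤ H z) (hHa : ∀ z, g z ≠ 0 → H z ≤ Real.exp (-a * z ^ 2))
    (hgM : ∀ z, |z| < δ → |g z| ≤ M * |z| ^ (-b))
    (hgl : ∀ v, v ≠ 0 → Tendsto (fun K : ℕ => (√K)⁻¹ ^ b * g (v / √K)) atTop (𝓝 (ℓ v)))
    (hHl : ∀ v, Tendsto (fun K : ℕ => H (v / √K) ^ K) atTop (𝓝 (Real.exp (-κ * v ^ 2)))) :
    Tendsto (fun K : ℕ => (K : ℝ) ^ ((1 - b) / 2) * ∫ z, g z * H z ^ K) atTop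
      (𝓝 (∫ v, ℓ v * Real.exp (-κ * v ^ 2))) := by
  have hpow : ∀ (K : ℕ) (z : ℝ), |g z * H z ^ K| ≤ |g z| * Real.exp (-a * z ^ 2) ^ K := by
    intro K z
    by_cases hz : g z = 0
    · simp [hz]
    · rw [abs_mul, abs_of_nonneg (pow_nonneg (hH0 z hz) K)]
      exact mul_le_mul_of_nonneg_left (pow_le_pow_left₀ (hH0 z hz) (hHa z hz) K) (abs_nonneg _)
  have hle1 : ∀ z : ℝ, Real.exp (-a * z ^ 2) ≤ 1 := fun z =>
    Real.exp_le_one_iff.2 (by nlinarith [sq_nonneg z])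
  have hint : ∀ K : ℕ, Integrable fun z => g z * H z ^ K := by
    intro K
    refine hg.mono (hg.aestronglyMeasurable.mul (hH.pow_const K).aestronglyMeasurable)
      (Eventually.of_forall fun z => ?_)
    rw [Real.norm_eq_abs, Real.norm_eq_abs]
    exact (hpow K z).trans (mul_le_of_le_one_right (abs_nonneg _)
      (pow_le_one₀ (Real.exp_pos _).le (hle1 z)))
  -- the contribution of `|z| < δ`, after the substitution `z = v / √K`
  have hnear : Tendsto (fun K : ℕ => (K : ℝ) ^ ((1 - b) / 2) *
      ∫ z, (Set.Ioo (-δ) δ).indicator (fun z => g z * H z ^ K) z) atTop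
      (𝓝 (∫ v, ℓ v * Real.exp (-κ * v ^ 2))) := by
    have hdom : Tendsto (fun K : ℕ => ∫ v, (√K)⁻¹ ^ b *
        (Set.Ioo (-δ) δ).indicator (fun z => g z * H z ^ K) (v / √K)) atTop
        (𝓝 (∫ v, ℓ v * Real.exp (-κ * v ^ 2))) := by
      refine tendsto_integral_filter_of_dominated_convergence
        (fun v => M * (|v| ^ (-b) * Real.exp (-a * v ^ 2))) ?_ ?_
        ((integrable_abs_rpow_mul_exp_neg_mul_sq ha hb).const_mul M) ?_
      · filter_upwards [eventually_ne_atTop 0] with K hK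
        have hK' : (√(K : ℝ)) ≠ 0 := by positivity
        exact ((((hint K).indicator measurableSet_Ioo).comp_div
          hK').const_mul _).aestronglyMeasurable
      · filter_upwards [eventually_ne_atTop 0] with K hK
        have hK' : 0 < √(K : ℝ) := by positivity
        have hKpos : (0 : ℝ) < K := by positivity
        refine Eventually.of_forall fun v => ?_
        rw [Real.norm_eq_abs, abs_mul, abs_of_nonneg (by positivity : 0 ≤ (√(K : ℝ))⁻¹ ^ b)]
        have hM0 : 0 ≤ M := by
          have h1 := hgM (δ / 2) (by rw [abs_of_pos (by linarith)]; linarith)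
          have h2 : 0 < |δ / 2| ^ (-b) := Real.rpow_pos_of_pos (by positivity) _
          exact nonneg_of_mul_nonneg_left ((abs_nonneg _).trans h1) h2
        by_cases hz : v / √K ∈ Set.Ioo (-δ) δ
        · rw [Set.indicator_of_mem hz]
          have h1 := hgM (v / √K) (abs_lt.2 hz)
          have h2 : Real.exp (-a * (v / √K) ^ 2) ^ K = Real.exp (-a * v ^ 2) := by
            rw [← Real.exp_nat_mul, div_pow, Real.sq_sqrt hKpos.le]
            congr 1
            field_simp
          have h3 : (√(K : ℝ))⁻¹ ^ b * |v / √K| ^ (-b) = |v| ^ (-b) := by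
            rw [abs_div, abs_of_pos hK', Real.div_rpow (abs_nonneg v) hK'.le,
              Real.inv_rpow hK'.le, Real.rpow_neg hK'.le]
            have : 0 < √(K : ℝ) ^ b := Real.rpow_pos_of_pos hK' b
            field_simp
          calc (√(K : ℝ))⁻¹ ^ b * |g (v / √K) * H (v / √K) ^ K|
              ≤ (√(K : ℝ))⁻¹ ^ b * (M * |v / √K| ^ (-b) * Real.exp (-a * v ^ 2)) := by
                refine mul_le_mul_of_nonneg_left ?_ (by positivity)
                refine (hpow K _).trans ?_
                rw [h2]
                exact mul_le_mul_of_nonneg_right h1 (Real.exp_pos _).le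
            _ = M * (|v| ^ (-b) * Real.exp (-a * v ^ 2)) := by
                rw [← h3]; ring
        · rw [Set.indicator_of_notMem hz, abs_zero, mul_zero]
          positivity
      · have h0 : ∀ᵐ v : ℝ, v ≠ 0 := by simp [ae_iff]
        filter_upwards [h0] with v hv
        refine ((hgl v hv).mul (hHl v)).congr' ?_
        have hsmall : Tendsto (fun K : ℕ => v / √(K : ℝ)) atTop (𝓝 0) :=
          (Real.tendsto_sqrt_atTop.comp tendsto_natCast_atTop_atTop).const_div_atTop v
        filter_upwards [hsmall (Ioo_mem_nhds (neg_lt_zero.2 hδ) hδ)] with K hK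
        rw [Set.indicator_of_mem (show v / √(K : ℝ) ∈ Set.Ioo (-δ) δ from hK)]
        ring
    refine hdom.congr' ?_
    filter_upwards [eventually_ne_atTop 0] with K hK
    have hKpos : (0 : ℝ) < K := by positivity
    rw [integral_const_mul, Measure.integral_comp_div, smul_eq_mul, ← mul_assoc,
      abs_of_nonneg (Real.sqrt_nonneg _)]
    congr 1
    rw [Real.inv_rpow (Real.sqrt_nonneg _), ← Real.rpow_neg (Real.sqrt_nonneg _),
      Real.sqrt_eq_rpow, ← Real.rpow_mul hKpos.le, ← Real.rpow_add hKpos]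
    congr 1
    ring
  have hfar : Tendsto (fun K : ℕ => (K : ℝ) ^ ((1 - b) / 2) *
      ∫ z, ((Set.Ioo (-δ) δ)ᶜ).indicator (fun z => g z * H z ^ K) z) atTop (𝓝 0) := by
    have h1 : Tendsto (fun K : ℕ => ((K : ℝ) ^ ((1 - b) / 2) * Real.exp (-(a * δ ^ 2) * K)) *
        ∫ z, |g z|) atTop (𝓝 0) := by
      have := ((tendsto_rpow_mul_exp_neg_mul_atTop_nhds_zero ((1 - b) / 2) (a * δ ^ 2)
        (by positivity)).comp tendsto_natCast_atTop_atTop).mul_const (∫ z, |g z|)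
      rwa [zero_mul] at this
    refine squeeze_zero_norm (fun K => ?_) h1
    rw [norm_mul, Real.norm_of_nonneg (by positivity), mul_assoc]
    refine mul_le_mul_of_nonneg_left ?_ (by positivity)
    rw [← integral_const_mul]
    refine norm_integral_le_of_norm_le (hg.abs.const_mul _) (Eventually.of_forall fun z => ?_)
    by_cases hz : z ∈ (Set.Ioo (-δ) δ)ᶜ
    · rw [Set.indicator_of_mem hz, Real.norm_eq_abs, mul_comm _ |g z|]
      refine (hpow K z).trans (mul_le_mul_of_nonneg_left ?_ (abs_nonneg _))
      rw [← Real.exp_nat_mul, Real.exp_le_exp]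
      have hz' : δ ≤ |z| := by
        by_contra hlt
        exact hz (abs_lt.1 (not_le.1 hlt))
      have h2 : δ ^ 2 ≤ z ^ 2 := by
        rw [← sq_abs z]
        exact pow_le_pow_left₀ hδ.le hz' 2
      have h3 : (0 : ℝ) ≤ K * a := by positivity
      nlinarith [mul_le_mul_of_nonneg_left h2 h3]
    · rw [Set.indicator_of_notMem hz, norm_zero]
      positivity
  have hsum := hnear.add hfar
  rw [add_zero] at hsum
  refine hsum.congr fun K => ?_
  rw [← mul_add, ← integral_add ((hint K).indicator measurableSet_Ioo)
    ((hint K).indicator measurableSet_Ioo.compl)]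
  congr 2
  funext z
  exact congrFun (Set.indicator_self_add_compl (Set.Ioo (-δ) δ) fun z => g z * H z ^ K) z

end Laplace

/-! ### The profile of the integrand -/

section Profile

/-- The function `q * (1 - q) ^ (d - 1)`, normalised to have maximum `1`. -/
noncomputable def criticalRatio (d : ℕ) (q : ℝ) : ℝ := q * (1 - q) ^ (d - 1) / criticalValue d

theorem criticalRatio_nonneg {d : ℕ} (hd : 1 ≤ d) {q : ℝ} (h0 : 0 ≤ q) (h1 : q ≤ 1) :
    0 ≤ criticalRatio d q :=
  div_nonneg (mul_nonneg h0 (pow_nonneg (by linarith) _)) (criticalValue_pos hd).le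

/-- A quadratic improvement of `1 + x ≤ exp x`, from this inequality for `√(1 + x)`. -/
theorem one_add_le_exp_sub_sq {x D : ℝ} (h0 : 0 ≤ 1 + x) (hD : 1 + x ≤ D) :
    1 + x ≤ Real.exp (x - x ^ 2 / (√D + 1) ^ 2) := by
  set r := √(1 + x) with hr
  have hr2 : r ^ 2 = 1 + x := Real.sq_sqrt h0
  have hr0 : 0 ≤ r := Real.sqrt_nonneg _
  have hrD : r ≤ √D := Real.sqrt_le_sqrt hD
  have h1 : r ≤ Real.exp (r - 1) := by linarith [Real.add_one_le_exp (r - 1)]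
  have h2 : x ^ 2 / (√D + 1) ^ 2 ≤ (r - 1) ^ 2 := by
    rw [div_le_iff₀ (by positivity)]
    have hx : x = (r - 1) * (r + 1) := by linarith
    rw [hx, mul_pow]
    gcongr
  calc 1 + x = r ^ 2 := hr2.symm
    _ ≤ Real.exp (r - 1) ^ 2 := pow_le_pow_left₀ hr0 h1 2
    _ = Real.exp (2 * (r - 1)) := by rw [← Real.exp_nat_mul]; norm_num
    _ ≤ _ := Real.exp_le_exp.2 (by nlinarith)

theorem criticalRatio_le {d : ℕ} (hd : 1 ≤ d) {q : ℝ} (h0 : 0 ≤ q) (h1 : q ≤ 1) :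
    criticalRatio d q ≤ Real.exp (-((d * q - 1) ^ 2 / (√d + 1) ^ 2)) := by
  have hd1 : (1 : ℝ) ≤ d := by exact_mod_cast hd
  set x : ℝ := d * q - 1 with hx
  have hA : d * q ≤ Real.exp (x - x ^ 2 / (√d + 1) ^ 2) := by
    have := one_add_le_exp_sub_sq (x := x) (D := d) (by rw [hx]; nlinarith) (by rw [hx]; nlinarith)
    linarith
  have hB : (1 - q) ^ (d - 1) ≤ (1 - 1 / (d : ℝ)) ^ (d - 1) * Real.exp (-x) := by
    rcases hd.eq_or_lt with rfl | hd2
    · have : 0 ≤ -x := by rw [hx]; push_cast; linarith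
      simpa using Real.one_le_exp this
    · have hd2' : (1 : ℝ) < d := by exact_mod_cast hd2
      have hcast : ((d - 1 : ℕ) : ℝ) = (d : ℝ) - 1 := by
        push_cast [Nat.cast_sub hd]; rfl
      have hpos : (0 : ℝ) < d - 1 := by linarith
      have h2 : 1 - q = (1 - 1 / (d : ℝ)) * (1 - x / (d - 1)) := by
        rw [hx]; field_simp; ring
      have h3 : 1 - x / (d - 1) ≤ Real.exp (-(x / (d - 1))) := by
        linarith [Real.add_one_le_exp (-(x / (d - 1)))]
      have h4 : 0 < 1 - 1 / (d : ℝ) := by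
        rw [sub_pos, div_lt_one (by linarith)]; exact hd2'
      have h5 : 0 ≤ 1 - x / ((d : ℝ) - 1) := by
        have : 0 ≤ (1 - 1 / (d : ℝ)) * (1 - x / (d - 1)) := by rw [← h2]; linarith
        exact nonneg_of_mul_nonneg_right this h4
      rw [h2, mul_pow]
      refine mul_le_mul_of_nonneg_left ?_ (pow_nonneg h4.le _)
      refine (pow_le_pow_left₀ h5 h3 _).trans (le_of_eq ?_)
      rw [← Real.exp_nat_mul, hcast]
      congr 1
      field_simp
  rw [criticalRatio, div_le_iff₀ (criticalValue_pos hd)]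
  have hq : q = 1 / d * (d * q) := by field_simp
  calc q * (1 - q) ^ (d - 1) = 1 / d * ((d * q) * (1 - q) ^ (d - 1)) := by
        rw [← mul_assoc, ← hq]
    _ ≤ 1 / d * (Real.exp (x - x ^ 2 / (√d + 1) ^ 2) *
          ((1 - 1 / (d : ℝ)) ^ (d - 1) * Real.exp (-x))) := by
        refine mul_le_mul_of_nonneg_left ?_ (by positivity)
        exact mul_le_mul hA hB (pow_nonneg (by linarith) _) (Real.exp_pos _).le
    _ = Real.exp (-(x ^ 2 / (√d + 1) ^ 2)) * criticalValue d := by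
        rw [criticalValue, show x - x ^ 2 / (√d + 1) ^ 2 = x + -(x ^ 2 / (√d + 1) ^ 2) by ring,
          Real.exp_add, Real.exp_neg x]
        field_simp

theorem tendsto_one_sub_div_sqrt_pow (u : ℝ) :
    Tendsto (fun K : ℕ => (1 - u / √K) ^ K * Real.exp (u * √K)) atTop
      (𝓝 (Real.exp (-(u ^ 2 / 2)))) := by
  have hsqrt : Tendsto (fun K : ℕ => √(K : ℝ)) atTop atTop :=
    Real.tendsto_sqrt_atTop.comp tendsto_natCast_atTop_atTop
  have hsmall : Tendsto (fun K : ℕ => u / √(K : ℝ)) atTop (𝓝 0) := hsqrt.const_div_atTop u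
  have hev : ∀ᶠ K : ℕ in atTop, |u / √(K : ℝ)| < 1 / 2 :=
    hsmall.abs.eventually_lt_const (by rw [abs_zero]; norm_num)
  have hlog : Tendsto (fun K : ℕ => (K : ℝ) * (u / √K + Real.log (1 - u / √K))) atTop
      (𝓝 (-(u ^ 2 / 2))) := by
    rw [tendsto_iff_norm_sub_tendsto_zero]
    refine squeeze_zero' (Eventually.of_forall fun _ => norm_nonneg _) ?_
      (hsqrt.const_div_atTop (2 * |u| ^ 3))
    filter_upwards [hev, eventually_ne_atTop 0] with K hK hK0
    have hKpos : (0 : ℝ) < K := by positivity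
    have hs : 0 < √(K : ℝ) := by positivity
    have h := Real.abs_log_sub_add_sum_range_le (hK.trans (by norm_num)) 2
    simp only [Finset.sum_range_succ, Finset.sum_range_zero, Nat.cast_zero, zero_add, pow_one,
      div_one, Nat.cast_one] at h
    have h2 : |u / √(K : ℝ)| ^ 3 / (1 - |u / √(K : ℝ)|) ≤ 2 * |u / √(K : ℝ)| ^ 3 := by
      rw [div_le_iff₀ (by linarith)]
      have : 0 ≤ |u / √(K : ℝ)| ^ 3 := by positivity
      nlinarith
    have h3 : (K : ℝ) * (u / √K + Real.log (1 - u / √K)) - -(u ^ 2 / 2) =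
        K * (u / √K + (u / √K) ^ (1 + 1) / (1 + 1) + Real.log (1 - u / √K)) := by
      rw [div_pow, Real.sq_sqrt hKpos.le]
      field_simp
      ring
    rw [Real.norm_eq_abs, h3, abs_mul, abs_of_pos hKpos]
    calc (K : ℝ) * _ ≤ K * (2 * |u / √(K : ℝ)| ^ 3) :=
          mul_le_mul_of_nonneg_left (h.trans h2) hKpos.le
      _ = 2 * |u| ^ 3 / √K := by
          rw [abs_div, abs_of_pos hs, div_pow]
          have : (K : ℝ) = √K * √K := (Real.mul_self_sqrt hKpos.le).symm
          rw [this, Real.sqrt_mul_self hs.le]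
          field_simp
  refine ((Real.continuous_exp.tendsto _).comp hlog).congr' ?_
  filter_upwards [hev, eventually_ne_atTop 0] with K hK hK0
  have hKpos : (0 : ℝ) < K := by positivity
  have hpos : 0 < 1 - u / √(K : ℝ) := by linarith [(abs_lt.1 hK).2]
  rw [Function.comp_apply, mul_add, Real.exp_add, mul_comm, Real.exp_nat_mul,
    Real.exp_log hpos]
  congr 2
  have hs : 0 < √(K : ℝ) := by positivity
  have : (K : ℝ) = √K * √K := (Real.mul_self_sqrt hKpos.le).symm
  nth_rewrite 1 [this]
  field_simp

/-- The profile is asymptotically Gaussian around its maximum. -/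
theorem tendsto_criticalRatio_pow {d : ℕ} (hd : 2 ≤ d) (c : ℝ) (v : ℝ) :
    Tendsto (fun K : ℕ => criticalRatio d (1 / d - v / √K / c) ^ K) atTop
      (𝓝 (Real.exp (-((d / c) ^ 2 / 2 * (1 + 1 / (d - 1))) * v ^ 2))) := by
  have hd2 : (2 : ℝ) ≤ d := by exact_mod_cast hd
  have hd1 : (0 : ℝ) < d - 1 := by linarith
  have hcast : ((d - 1 : ℕ) : ℝ) = (d : ℝ) - 1 := by
    push_cast [Nat.cast_sub (by omega : 1 ≤ d)]; rfl
  set u : ℝ := d / c * v with hu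
  have h1 := tendsto_one_sub_div_sqrt_pow u
  have h2 := (tendsto_one_sub_div_sqrt_pow (-(u / (d - 1)))).pow (d - 1)
  refine ((h1.mul h2).congr fun K => ?_).trans (le_of_eq ?_)
  · have hexp : Real.exp (u * √K) * Real.exp (-(u / (d - 1)) * √K) ^ (d - 1) = 1 := by
      rw [← Real.exp_nat_mul, hcast, ← Real.exp_add]
      rw [Real.exp_eq_one_iff]
      field_simp
      ring
    have hratio : criticalRatio d (1 / d - v / √K / c) =
        (1 - u / √K) * (1 - -(u / (d - 1)) / √K) ^ (d - 1) := by
      have h3 : 1 / (d : ℝ) - v / √K / c = 1 / d * (1 - u / √K) := by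
        rw [hu]
        field_simp
      have h4 : 1 - (1 / (d : ℝ) - v / √K / c) =
          (1 - 1 / d) * (1 - -(u / (d - 1)) / √K) := by
        rw [h3]
        rw [neg_div, div_right_comm u]
        field_simp
        ring
      rw [criticalRatio, h4, mul_pow, h3, criticalValue]
      have h5 : (0 : ℝ) < 1 - 1 / d := by
        rw [sub_pos, div_lt_one (by linarith)]; linarith
      have h6 : (0 : ℝ) < (1 - 1 / d) ^ (d - 1) := pow_pos h5 _
      field_simp
    rw [hratio]
    calc _ = (1 - u / √K) ^ K * ((1 - -(u / (d - 1)) / √K) ^ (d - 1)) ^ K *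
          (Real.exp (u * √K) * Real.exp (-(u / (d - 1)) * √K) ^ (d - 1)) := by
          rw [← pow_mul, mul_pow, ← pow_mul, mul_comm K (d - 1)]; ring
      _ = _ := by rw [hexp, mul_one, mul_pow]
  · congr 1
    rw [← Real.exp_nat_mul, hcast, ← Real.exp_add, hu]
    congr 1
    field_simp
    ring

end Profile

/-! ### Asymptotics of the cluster probabilities -/

section Asymptotics

variable {d : ℕ} {α : ℝ}

theorem tendsto_card_rootedSubtrees (hd : 2 ≤ d) : ∃ c : ℝ, 0 < c ∧
    Tendsto (fun k : ℕ => (k : ℝ) ^ (3 / 2 : ℝ) *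
      ((rootedSubtrees d k).card * criticalValue d ^ k)) atTop (𝓝 c) := by
  obtain ⟨c, hc, hlim⟩ := tendsto_sqrt_mul_choose hd
  have hd2 : (2 : ℝ) ≤ d := by exact_mod_cast hd
  have hd1 : (0 : ℝ) < d - 1 := by linarith
  have h1 : Tendsto (fun k : ℕ => (k : ℝ) / (k + 1 / ((d : ℝ) - 1)) * (1 / ((d : ℝ) - 1))) atTop
      (𝓝 (1 * (1 / ((d : ℝ) - 1)))) := (tendsto_natCast_div_add_atTop _).mul_const _
  refine ⟨_, ?_, (hlim.mul h1).congr' ?_⟩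
  · positivity
  · filter_upwards [eventually_ne_atTop 0] with k hk
    have hkpos : (0 : ℝ) < k := by positivity
    rw [← card_rootedSubtrees (by omega) hk, Real.sqrt_eq_rpow,
      show (3 / 2 : ℝ) = 1 / 2 + 1 by norm_num, Real.rpow_add hkpos, Real.rpow_one]
    have : (k : ℝ) + 1 / (d - 1) ≠ 0 := by positivity
    have h3 : (k : ℝ) / (k + 1 / ((d : ℝ) - 1)) * (1 / ((d : ℝ) - 1)) =
        k / ((d - 1) * k + 1) := by
      field_simp
    rw [h3]
    have : ((d : ℝ) - 1) * k + 1 ≠ 0 := by positivity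
    field_simp

/-- The probabilities of the cluster sizes as integrals: conditionally on the time of its
freezing, the root cluster is a cluster of Bernoulli percolation with parameter
`q = (1 - y) / (1 + α)`. -/
theorem IsPCFMeasure.real_rootClusterSize_succ (hd : 1 ≤ d) (hα : 0 < α)
    {μ : Measure ((daryTree d).edgeSet → Bool)} (hμ : IsPCFMeasure (daryTree d) α μ) (K : ℕ) :
    μ.real (rootClusterSize d (K + 1)) =
      (rootedSubtrees d (K + 1)).card * criticalValue d ^ K *
        ∫ y in (0 : ℝ)..1, (α / (1 + α)) * y ^ (-(1 / (1 + α))) *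
          ((1 - (1 - y) / (1 + α)) ^ d * criticalRatio d ((1 - y) / (1 + α)) ^ K) := by
  have he : d * (K + 1) - (K + 1 - 1) = (d - 1) * K + d := by
    obtain ⟨e, rfl⟩ : ∃ e, d = e + 1 := ⟨d - 1, by omega⟩
    have : (e + 1) * (K + 1) = K + (e * K + e + 1) := by ring
    simp only [add_tsub_cancel_right, this, add_tsub_cancel_left]
    ring
  rw [hμ.real_rootClusterSize hα, he, openClosedProb_eq_integral hα, mul_assoc,
    ← intervalIntegral.integral_const_mul (criticalValue d ^ K)]
  congr 2
  funext y
  rw [criticalRatio, add_tsub_cancel_right]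
  generalize (1 - y) / (1 + α) = q
  rw [div_pow, mul_pow, ← pow_mul, pow_add]
  have := pow_pos (criticalValue_pos hd) K
  field_simp

theorem IsPCFMeasure.exists_exponential_bound (hd : 1 ≤ d) (hα : 0 < α)
    {μ : Measure ((daryTree d).edgeSet → Bool)} (hμ : IsPCFMeasure (daryTree d) α μ)
    (hsub : (d : ℝ) - 1 < α) : ∃ C c : ℝ, 0 < C ∧ 0 < c ∧
      ∀ k : ℕ, μ.real (rootClusterSize d k) ≤ C * Real.exp (-c * k) := by
  have hd1 : (1 : ℝ) ≤ d := by exact_mod_cast hd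
  have hs : 1 / (1 + α) < 1 := by rw [div_lt_one (by linarith)]; linarith
  have hds : d * (1 / (1 + α)) < 1 := by
    rw [mul_one_div, div_lt_one (by linarith)]; linarith
  set c : ℝ := (1 - d * (1 / (1 + α))) ^ 2 / (√d + 1) ^ 2 with hc
  have hcpos : 0 < c := div_pos (pow_pos (by linarith) 2) (by positivity)
  have hM := criticalValue_pos hd
  refine ⟨(criticalValue d)⁻¹ * Real.exp c, c, by positivity, hcpos, fun k => ?_⟩
  cases k with
  | zero =>
    rw [hμ.real_rootClusterSize hα, rootedSubtrees_zero]
    simp only [Finset.card_empty, Nat.cast_zero, zero_mul]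
    positivity
  | succ K =>
    have hint : ∀ f : ℝ → ℝ, Continuous f → IntervalIntegrable
        (fun y : ℝ => (α / (1 + α)) * y ^ (-(1 / (1 + α))) * f y) volume 0 1 := by
      intro f hf
      simpa only [mul_assoc] using (intervalIntegrable_rpow_neg_mul hs hf).const_mul (α / (1 + α))
    have hI : (∫ y in (0 : ℝ)..1, (α / (1 + α)) * y ^ (-(1 / (1 + α))) *
        ((1 - (1 - y) / (1 + α)) ^ d * criticalRatio d ((1 - y) / (1 + α)) ^ K)) ≤
        Real.exp (-c * K) := by
      have h1 : (∫ y in (0 : ℝ)..1, (α / (1 + α)) * y ^ (-(1 / (1 + α))) * Real.exp (-c * K)) =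
          Real.exp (-c * K) := by
        have := allOpenProb_eq_integral hα 0
        simp only [allOpenProb_zero, pow_zero, mul_one] at this
        rw [intervalIntegral.integral_mul_const, ← this, one_mul]
      rw [← h1]
      refine intervalIntegral.integral_mono_on zero_le_one (hint _ ?_)
        (hint _ continuous_const) fun y hy => ?_
      · unfold criticalRatio
        fun_prop
      · have hq0 : 0 ≤ (1 - y) / (1 + α) := div_nonneg (by linarith [hy.2]) (by linarith)
        have hqs : (1 - y) / (1 + α) ≤ 1 / (1 + α) :=
          div_le_div_of_nonneg_right (by linarith [hy.1]) (by linarith)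
        have hq1 : (1 - y) / (1 + α) ≤ 1 := hqs.trans hs.le
        refine mul_le_mul_of_nonneg_left ?_
          (mul_nonneg (by positivity) (Real.rpow_nonneg hy.1 _))
        refine (mul_le_of_le_one_left (pow_nonneg (criticalRatio_nonneg hd hq0 hq1) K)
          (pow_le_one₀ (by linarith) (by linarith))).trans ?_
        rw [show -c * (K : ℝ) = K * -c by ring, Real.exp_nat_mul]
        refine pow_le_pow_left₀ (criticalRatio_nonneg hd hq0 hq1) ?_ K
        refine (criticalRatio_le hd hq0 hq1).trans (Real.exp_le_exp.2 (neg_le_neg ?_))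
        rw [hc]
        refine div_le_div_of_nonneg_right ?_ (by positivity)
        have h2 : (d : ℝ) * ((1 - y) / (1 + α)) ≤ d * (1 / (1 + α)) :=
          mul_le_mul_of_nonneg_left hqs (by linarith)
        nlinarith
    have hN : ((rootedSubtrees d (K + 1)).card : ℝ) * criticalValue d ^ K ≤
        (criticalValue d)⁻¹ := by
      rw [← one_div, le_div_iff₀ hM, mul_assoc, ← pow_succ]
      exact card_rootedSubtrees_mul_criticalValue_pow_le_one hd (K + 1)
    rw [hμ.real_rootClusterSize_succ hd hα]
    calc _ ≤ (criticalValue d)⁻¹ * Real.exp (-c * K) := by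
          refine mul_le_mul hN hI ?_ (by positivity)
          refine intervalIntegral.integral_nonneg zero_le_one fun y hy => ?_
          have hq0 : 0 ≤ (1 - y) / (1 + α) := div_nonneg (by linarith [hy.2]) (by linarith)
          have hq1 : (1 - y) / (1 + α) ≤ 1 := by
            rw [div_le_one (by linarith)]; linarith [hy.1]
          refine mul_nonneg (mul_nonneg (by positivity) (Real.rpow_nonneg hy.1 _)) ?_
          exact mul_nonneg (pow_nonneg (by linarith) d)
            (pow_nonneg (criticalRatio_nonneg hd hq0 hq1) K)
      _ = (criticalValue d)⁻¹ * Real.exp c * Real.exp (-c * (K + 1 : ℕ)) := by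
          rw [mul_assoc, ← Real.exp_add]
          congr 2
          push_cast
          ring

/-- The weight in the integral formula as a function of the distance `z = y - (1 - (1 + α) / d)`
to the point where `q = 1 / d`. -/
noncomputable def laplaceWeight (d : ℕ) (α z : ℝ) : ℝ :=
  (Set.Ioc 0 1).indicator (fun y : ℝ => (α / (1 + α)) * y ^ (-(1 / (1 + α))) *
    (1 - (1 - y) / (1 + α)) ^ d) (1 - (1 + α) / d + z)

theorem integral_eq_integral_laplaceWeight (hd : 1 ≤ d) (hα : 0 < α) (K : ℕ) :
    (∫ y in (0 : ℝ)..1, (α / (1 + α)) * y ^ (-(1 / (1 + α))) *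
      ((1 - (1 - y) / (1 + α)) ^ d * criticalRatio d ((1 - y) / (1 + α)) ^ K)) =
    ∫ z, laplaceWeight d α z * criticalRatio d (1 / d - z / (1 + α)) ^ K := by
  have hd1 : (1 : ℝ) ≤ d := by exact_mod_cast hd
  rw [intervalIntegral.integral_of_le zero_le_one, ← integral_indicator measurableSet_Ioc,
    ← integral_add_left_eq_self _ (1 - (1 + α) / d)]
  congr 1
  funext z
  have hq : 1 / (d : ℝ) - z / (1 + α) = (1 - (1 - (1 + α) / d + z)) / (1 + α) := by
    field_simp
    ring
  rw [laplaceWeight, hq]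
  by_cases h : 1 - (1 + α) / d + z ∈ Set.Ioc (0 : ℝ) 1
  · rw [Set.indicator_of_mem h, Set.indicator_of_mem h]
    ring
  · rw [Set.indicator_of_notMem h, Set.indicator_of_notMem h, zero_mul]

theorem integrable_laplaceWeight (d : ℕ) (hα : 0 < α) : Integrable (laplaceWeight d α) := by
  have hs : 1 / (1 + α) < 1 := by rw [div_lt_one (by linarith)]; linarith
  have h := (intervalIntegrable_rpow_neg_mul (f := fun y : ℝ => (1 - (1 - y) / (1 + α)) ^ d) hs
    (by fun_prop)).const_mul (α / (1 + α))
  rw [intervalIntegrable_iff_integrableOn_Ioc_of_le zero_le_one] at h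
  have h2 := ((integrable_indicator_iff measurableSet_Ioc).2 h).comp_add_left (1 - (1 + α) / d)
  unfold laplaceWeight
  simpa only [mul_assoc] using h2

/-- The polynomial decay of the cluster probabilities, from the behaviour of the weight near the
point where `q = 1 / d`. -/
theorem IsPCFMeasure.exists_isEquivalent (hd : 2 ≤ d) (hα : 0 < α)
    {μ : Measure ((daryTree d).edgeSet → Bool)} (hμ : IsPCFMeasure (daryTree d) α μ)
    {ℓ : ℝ → ℝ} {b δ M : ℝ} (hb : b < 1) (hδ : 0 < δ)
    (hgM : ∀ z, |z| < δ → |laplaceWeight d α z| ≤ M * |z| ^ (-b))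
    (hgl : ∀ v, v ≠ 0 →
      Tendsto (fun K : ℕ => (√K)⁻¹ ^ b * laplaceWeight d α (v / √K)) atTop (𝓝 (ℓ v)))
    (hℓ : ∀ κ : ℝ, 0 < κ → 0 < ∫ v, ℓ v * Real.exp (-κ * v ^ 2)) :
    ∃ C : ℝ, 0 < C ∧ (fun k : ℕ => μ.real (rootClusterSize d k)) ~[atTop]
      fun k : ℕ => C * (k : ℝ) ^ (-(2 - b / 2)) := by
  have hd1 : 1 ≤ d := by omega
  have hd2 : (2 : ℝ) ≤ d := by exact_mod_cast hd
  have hd0 : (0 : ℝ) < d - 1 := by linarith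
  set κ : ℝ := (d / (1 + α)) ^ 2 / 2 * (1 + 1 / (d - 1)) with hκ
  have hκpos : 0 < κ := by positivity
  have hsupp : ∀ z, laplaceWeight d α z ≠ 0 →
      0 ≤ 1 / (d : ℝ) - z / (1 + α) ∧ 1 / (d : ℝ) - z / (1 + α) ≤ 1 := by
    intro z hz
    have hmem : 1 - (1 + α) / d + z ∈ Set.Ioc (0 : ℝ) 1 := by
      by_contra h
      exact hz (Set.indicator_of_notMem h _)
    have hq : 1 / (d : ℝ) - z / (1 + α) = (1 - (1 - (1 + α) / d + z)) / (1 + α) := by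
      field_simp
      ring
    rw [hq]
    refine ⟨div_nonneg (by linarith [hmem.2]) (by linarith), ?_⟩
    rw [div_le_one (by linarith)]
    linarith [hmem.1]
  have hL := tendsto_laplace (g := laplaceWeight d α)
    (H := fun z => criticalRatio d (1 / d - z / (1 + α)))
    (a := (d / (1 + α)) ^ 2 / (√d + 1) ^ 2) (b := b) (κ := κ) (by positivity) hb hδ
    (integrable_laplaceWeight d hα)
    (by unfold criticalRatio; fun_prop)
    (fun z hz => criticalRatio_nonneg hd1 (hsupp z hz).1 (hsupp z hz).2)
    (fun z hz => by
      refine (criticalRatio_le hd1 (hsupp z hz).1 (hsupp z hz).2).trans (le_of_eq ?_)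
      congr 1
      field_simp
      ring) hgM hgl (fun v => tendsto_criticalRatio_pow hd (1 + α) v)
  obtain ⟨c, hc, hcard⟩ := tendsto_card_rootedSubtrees hd
  have hratio : Tendsto (fun K : ℕ => (((K : ℝ) / (K + 1))⁻¹) ^ ((1 - b) / 2)) atTop
      (𝓝 ((1 : ℝ)⁻¹ ^ ((1 - b) / 2))) :=
    ((tendsto_natCast_div_add_atTop (1 : ℝ)).inv₀ one_ne_zero).rpow_const
      (Or.inl (by norm_num))
  have hprod := (((hcard.comp (tendsto_add_atTop_nat 1)).mul_const
    (criticalValue d)⁻¹).mul hratio).mul hL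
  set C : ℝ := c * (criticalValue d)⁻¹ * (1 : ℝ)⁻¹ ^ ((1 - b) / 2) *
    ∫ v, ℓ v * Real.exp (-κ * v ^ 2) with hC
  have hM := criticalValue_pos hd1
  have hCpos : 0 < C := by
    have := hℓ κ hκpos
    rw [inv_one, Real.one_rpow] at hC
    positivity
  have hlim : Tendsto (fun k : ℕ => μ.real (rootClusterSize d k) * (k : ℝ) ^ (2 - b / 2)) atTop
      (𝓝 C) := by
    rw [← tendsto_add_atTop_iff_nat 1]
    refine hprod.congr' ?_
    filter_upwards [eventually_ne_atTop 0] with K hK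
    have hKpos : (0 : ℝ) < K := by positivity
    have hK1 : (0 : ℝ) < (K : ℝ) + 1 := by positivity
    rw [hμ.real_rootClusterSize_succ hd1 hα, integral_eq_integral_laplaceWeight hd1 hα,
      Function.comp_apply, inv_div, Real.div_rpow hK1.le hKpos.le,
      show (2 - b / 2 : ℝ) = 3 / 2 + (1 - b) / 2 by ring, Real.rpow_add (by positivity)]
    have := (Real.rpow_pos_of_pos hKpos ((1 - b) / 2)).ne'
    push_cast
    rw [pow_succ]
    field_simp
  refine ⟨C, hCpos, ?_⟩
  have hequiv := ((isEquivalent_const_iff_tendsto hCpos.ne').2 hlim).mul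
    (IsEquivalent.refl (u := fun k : ℕ => (k : ℝ) ^ (-(2 - b / 2))))
  refine hequiv.congr_left ?_
  filter_upwards [eventually_ne_atTop 0] with k hk
  have hkpos : (0 : ℝ) < k := by positivity
  rw [Pi.mul_apply, mul_assoc, ← Real.rpow_add hkpos, add_neg_cancel, Real.rpow_zero, mul_one]

theorem IsPCFMeasure.exists_isEquivalent_supercritical (hα : 0 < α)
    {μ : Measure ((daryTree d).edgeSet → Bool)} (hμ : IsPCFMeasure (daryTree d) α μ)
    (hsup : α < (d : ℝ) - 1) : ∃ C : ℝ, 0 < C ∧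
      (fun k : ℕ => μ.real (rootClusterSize d k)) ~[atTop] fun k : ℕ => C * (k : ℝ) ^ (-2 : ℝ) := by
  have hd2 : 2 ≤ d := by
    have : (1 : ℝ) < d := by linarith
    exact_mod_cast this
  have hdpos : (0 : ℝ) < d := by positivity
  have hy1 : (1 + α) / d < 1 := by rw [div_lt_one hdpos]; linarith
  have hy0 : 0 < (1 + α) / d := by positivity
  -- the point where `q = 1 / d` is in the interior, so the weight is continuous there
  have hcont : ContinuousAt (laplaceWeight d α) 0 := by
    have h1 : ContinuousAt (fun z : ℝ => (α / (1 + α)) *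
        (1 - (1 + α) / d + z) ^ (-(1 / (1 + α))) *
        (1 - (1 - (1 - (1 + α) / d + z)) / (1 + α)) ^ d) 0 := by
      refine ContinuousAt.mul (ContinuousAt.mul continuousAt_const ?_) (by fun_prop)
      exact ContinuousAt.rpow_const (by fun_prop) (Or.inl (by simp only [add_zero]; linarith))
    refine h1.congr ?_
    have hnhds : Set.Ioo (-(1 - (1 + α) / d)) ((1 + α) / d) ∈ 𝓝 (0 : ℝ) :=
      Ioo_mem_nhds (by linarith) hy0
    filter_upwards [hnhds] with z hz
    rw [laplaceWeight, Set.indicator_of_mem]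
    exact ⟨by linarith [hz.1], by linarith [hz.2]⟩
  have hg0 : 0 < laplaceWeight d α 0 := by
    rw [laplaceWeight, Set.indicator_of_mem]
    · have h1 : 0 < 1 - (1 - (1 - (1 + α) / d + 0)) / (1 + α) := by
        rw [sub_pos, div_lt_one (by linarith)]
        linarith
      have h2 : 0 < (1 - (1 + α) / d + 0) ^ (-(1 / (1 + α))) :=
        Real.rpow_pos_of_pos (by linarith) _
      positivity
    · exact ⟨by linarith, by linarith⟩
  obtain ⟨δ, hδ, hδM⟩ := Metric.eventually_nhds_iff.1
    (hcont.abs.eventually_lt_const (lt_add_one _))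
  have h := hμ.exists_isEquivalent hd2 hα (b := 0) (δ := δ) (M := |laplaceWeight d α 0| + 1)
    (ℓ := fun _ => laplaceWeight d α 0) one_pos hδ ?_ ?_ ?_
  · simpa using h
  · intro z hz
    rw [neg_zero, Real.rpow_zero, mul_one]
    exact (hδM (by simpa using hz)).le
  · intro v _
    simp only [Real.rpow_zero, one_mul]
    have hsmall : Tendsto (fun K : ℕ => v / √(K : ℝ)) atTop (𝓝 0) :=
      (Real.tendsto_sqrt_atTop.comp tendsto_natCast_atTop_atTop).const_div_atTop v
    exact hcont.tendsto.comp hsmall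
  · intro κ hκ
    rw [integral_const_mul, integral_gaussian]
    positivity

theorem IsPCFMeasure.exists_isEquivalent_critical (hα : 0 < α)
    {μ : Measure ((daryTree d).edgeSet → Bool)} (hμ : IsPCFMeasure (daryTree d) α μ)
    (hcrit : α = (d : ℝ) - 1) : ∃ C : ℝ, 0 < C ∧
      (fun k : ℕ => μ.real (rootClusterSize d k)) ~[atTop]
        fun k : ℕ => C * (k : ℝ) ^ (-(2 - 1 / (2 * (d : ℝ)))) := by
  have hd2 : 2 ≤ d := by
    have : (1 : ℝ) < d := by linarith
    exact_mod_cast this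
  have hd2' : (2 : ℝ) ≤ d := by exact_mod_cast hd2
  have hdpos : (0 : ℝ) < d := by positivity
  have hd : 1 + α = d := by linarith
  have hb : 1 / (d : ℝ) < 1 := by rw [div_lt_one hdpos]; linarith
  have hA : 0 < α / d := by positivity
  have hweight : ∀ z, laplaceWeight d α z = (Set.Ioc 0 1).indicator
      (fun y : ℝ => (α / d) * y ^ (-(1 / (d : ℝ))) * (1 - (1 - y) / d) ^ d) z := by
    intro z
    rw [laplaceWeight, hd, div_self hdpos.ne', sub_self, zero_add]
  have hE : 0 < (α / d) * (1 - (1 - 0) / (d : ℝ)) ^ d := by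
    have : 0 < 1 - (1 - 0) / (d : ℝ) := by rw [sub_zero]; linarith
    positivity
  have h := hμ.exists_isEquivalent hd2 hα (b := 1 / d) (δ := 1) (M := α / d)
    (ℓ := (Set.Ioi 0).indicator fun v : ℝ =>
      (α / d) * (1 - (1 - 0) / (d : ℝ)) ^ d * v ^ (-(1 / (d : ℝ)))) hb one_pos ?_ ?_ ?_
  · have he : 1 / (d : ℝ) / 2 = 1 / (2 * d) := by field_simp
    rwa [he] at h
  · intro z _
    rw [hweight]
    have hnn : 0 ≤ |z| ^ (-(1 / (d : ℝ))) := Real.rpow_nonneg (abs_nonneg z) _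
    by_cases hz : z ∈ Set.Ioc (0 : ℝ) 1
    · have h1 : 0 ≤ (1 - z) / d := div_nonneg (by linarith [hz.2]) hdpos.le
      have h2 : (1 - z) / d ≤ 1 := by
        rw [div_le_one hdpos]
        linarith [hz.1]
      have h3 : 0 ≤ (1 - (1 - z) / (d : ℝ)) ^ d := pow_nonneg (by linarith) d
      rw [Set.indicator_of_mem hz, abs_mul, abs_mul, abs_of_pos hA, abs_of_nonneg h3,
        Real.abs_rpow_of_nonneg hz.1.le]
      exact mul_le_of_le_one_right (by positivity) (pow_le_one₀ (by linarith) (by linarith))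
    · rw [Set.indicator_of_notMem hz, abs_zero]
      positivity
  · intro v hv
    have hsmall : Tendsto (fun K : ℕ => v / √(K : ℝ)) atTop (𝓝 0) :=
      (Real.tendsto_sqrt_atTop.comp tendsto_natCast_atTop_atTop).const_div_atTop v
    rcases hv.lt_or_gt with hv | hv
    · rw [Set.indicator_of_notMem (by simpa using hv.le)]
      refine tendsto_const_nhds.congr fun K => ?_
      have : v / √(K : ℝ) ≤ 0 := div_nonpos_of_nonpos_of_nonneg hv.le (Real.sqrt_nonneg _)
      rw [hweight, Set.indicator_of_notMem (fun h => absurd h.1 (not_lt.2 this)), mul_zero]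
    · rw [Set.indicator_of_mem (Set.mem_Ioi.2 hv)]
      have hcont : Continuous fun z : ℝ => (α / d) * (1 - (1 - z) / (d : ℝ)) ^ d *
          v ^ (-(1 / (d : ℝ))) := by fun_prop
      refine ((hcont.tendsto 0).comp hsmall).congr' ?_
      filter_upwards [eventually_ne_atTop 0, hsmall.eventually_lt_const one_pos] with K hK hK1
      have hs : 0 < √(K : ℝ) := by positivity
      rw [hweight, Set.indicator_of_mem
          (show v / √(K : ℝ) ∈ Set.Ioc 0 1 from ⟨div_pos hv hs, hK1.le⟩), Function.comp_apply,
        Real.div_rpow hv.le hs.le, Real.inv_rpow hs.le, Real.rpow_neg hs.le]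
      have := Real.rpow_pos_of_pos hs (1 / (d : ℝ))
      field_simp
  · intro κ hκ
    have h1 : ∀ v : ℝ, (Set.Ioi 0).indicator (fun v : ℝ =>
        (α / d) * (1 - (1 - 0) / (d : ℝ)) ^ d * v ^ (-(1 / (d : ℝ)))) v *
          Real.exp (-κ * v ^ 2) = (Set.Ioi 0).indicator (fun v : ℝ =>
        (α / d) * (1 - (1 - 0) / (d : ℝ)) ^ d *
          (v ^ (-(1 / (d : ℝ))) * Real.exp (-κ * v ^ (2 : ℝ)))) v := by
      intro v
      by_cases hv : v ∈ Set.Ioi (0 : ℝ)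
      · rw [Set.indicator_of_mem hv, Set.indicator_of_mem hv, Real.rpow_two, mul_assoc]
      · rw [Set.indicator_of_notMem hv, Set.indicator_of_notMem hv, zero_mul]
    simp_rw [h1]
    rw [integral_indicator measurableSet_Ioi, integral_const_mul,
      integral_rpow_mul_exp_neg_mul_rpow two_pos (by linarith) hκ]
    have hΓ : 0 < Real.Gamma ((-(1 / (d : ℝ)) + 1) / 2) :=
      Real.Gamma_pos_of_pos (by linarith)
    have := Real.rpow_pos_of_pos hκ (-(-(1 / (d : ℝ)) + 1) / 2)
    positivity

end Asymptotics

theorem theorem3 (d : ℕ) (hd : 1 ≤ d) (α : ℝ) (hα : 0 < α) :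
    (∃ μ : Measure ((daryTree d).edgeSet → Bool), IsPCFMeasure (daryTree d) α μ) ∧
    ∀ μ : Measure ((daryTree d).edgeSet → Bool), IsPCFMeasure (daryTree d) α μ →
      (α < (d : ℝ) - 1 → ∃ C : ℝ, 0 < C ∧
        (fun k : ℕ => μ.real (rootClusterSize d k)) ~[atTop]
          fun k : ℕ => C * (k : ℝ) ^ (-2 : ℝ)) ∧
      (α = (d : ℝ) - 1 → ∃ C : ℝ, 0 < C ∧
        (fun k : ℕ => μ.real (rootClusterSize d k)) ~[atTop]
          fun k : ℕ => C * (k : ℝ) ^ (-(2 - 1 / (2 * (d : ℝ))))) ∧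
      ((d : ℝ) - 1 < α → ∃ C c : ℝ, 0 < C ∧ 0 < c ∧
        ∀ k : ℕ, μ.real (rootClusterSize d k) ≤ C * Real.exp (-c * k)) :=
  ⟨exists_isPCFMeasure d hα, fun _ hμ => ⟨hμ.exists_isEquivalent_supercritical hα,
    hμ.exists_isEquivalent_critical hα, hμ.exists_exponential_bound hd hα⟩⟩
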